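/- Let $k$ be an infinite field, $S=k[x_1,\ldots,x_n]$ the standard graded polynomial ring, and $S(m)=k[x_1,\ldots,x_m]$ for $m\le n$. For a homogeneous ideal $I$ of $S$ let $\operatorname{gin}(I)$ be its generic initial ideal with respect to the graded reverse lexicographic order with $x_1>x_2>\cdots>x_n$, i.e. the common value of $\operatorname{in}(\alpha(I))$ for all $\alpha$ in some nonempty Zariski open subset of $GL_n(k)$. For a monomial ideal $J\subset S$ with minimal monomial generators $u_1,\ldots,u_m$ let $\Phi_r(J)\subset S$ be the ideal generated by the monomials obtained from $u_1,\ldots,u_m$ by setting $x_{r+1}=\cdots=x_n=1$, and let $\Pi_r(J)\subset S(r)$ be the image of $J$ under the $k$-algebra map $\Pi_r:S\to S(r)$ that sends $x_{r+1},\ldots,x_n$ to $0$ and fixes $x_1,\ldots,x_r$. For a graded quotient ring $A\neq 0$ of a polynomial ring, with Hilbert series $q(t)/(1-t)^{\dim A}$, let $\deg A=q(1)$ be its multiplicity, let $\operatorname{depth}A$ be its depth with respect to its maximal homogeneous ideal, and call $A$ almost Cohen–Macaulay if $\operatorname{depth}A\ge\dim A-1$. Let $P$ be a homogeneous prime ideal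 of $S$, let $d=\dim S/P$, $c=n-d$ and $J=\operatorname{gin}(P)$, and suppose that $$\deg\bigl(S/\Phi_c(J)\bigr)+1=\deg\bigl(S(c)/\Pi_c(J)\bigr).$$ Then $d\ge 1$, $J=(J\cap k[x_1,\ldots,x_{c+1}])S$, and $x_{c+1}$ divides some minimal monomial generator of $J$. Moreover $\operatorname{depth}(S/P)=d-1$, so that $S/P$ is almost Cohen–Macaulay. -/

import Mathlib

open MvPolynomial

noncomputable section

namespace GinDepth

/-! ### The graded reverse lexicographic order

The variable `x_{i+1}` of the text is `X i`, with `i : Fin n`; `x_1 > x_2 > ... > x_n`. -/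

/-- Exponent vectors, to be ordered by the graded reverse lexicographic order. -/
def RevLex (n : ℕ) : Type := Fin n →₀ ℕ

instance (n : ℕ) : AddCommMonoid (RevLex n) := inferInstanceAs (AddCommMonoid (Fin n →₀ ℕ))

/-- The identity map, additively. -/
def toRevLex {n : ℕ} : (Fin n →₀ ℕ) ≃+ RevLex n where
  toFun u := u
  invFun u := u
  left_inv _ := rfl
  right_inv _ := rfl
  map_add' _ _ := rfl

/-- Compare first the total degrees; if these agree, look at the last coordinate in which the two
vectors differ, the vector with the larger entry there being the smaller one. -/
def RevLex.key {n : ℕ} (u : RevLex n) : ℕ ×ₗ Colex (Fin n → ℕᵒᵈ) :=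
  toLex ((toRevLex.symm u).degree, toColex fun i => OrderDual.toDual (toRevLex.symm u i))

theorem RevLex.key_injective {n : ℕ} : Function.Injective (RevLex.key (n := n)) := by
  intro u v h
  have h2 := congrArg (fun p => ofColex (ofLex p).2) h
  exact toRevLex.symm.injective
    (Finsupp.ext fun i => OrderDual.toDual.injective (congrFun h2 i))

instance (n : ℕ) : LinearOrder (RevLex n) := LinearOrder.lift' RevLex.key RevLex.key_injective

theorem RevLex.lt_iff {n : ℕ} {u v : Fin n →₀ ℕ} :
    toRevLex u < toRevLex v ↔
      u.degree < v.degree ∨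
        (u.degree = v.degree ∧ ∃ i, (∀ j, i < j → u j = v j) ∧ v i < u i) := by
  change RevLex.key (toRevLex u) < RevLex.key (toRevLex v) ↔ _
  rw [RevLex.key, RevLex.key, Prod.Lex.toLex_lt_toLex]
  rfl

instance (n : ℕ) : IsOrderedAddMonoid (RevLex n) where
  add_le_add_left u v h w := by
    obtain ⟨u, rfl⟩ := toRevLex.surjective u
    obtain ⟨v, rfl⟩ := toRevLex.surjective v
    obtain ⟨w, rfl⟩ := toRevLex.surjective w
    rcases h.eq_or_lt with h | h
    · rw [h]
    · rw [← map_add, ← map_add]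
      refine le_of_lt (RevLex.lt_iff.2 ?_)
      rcases RevLex.lt_iff.1 h with h | ⟨h, i, h1, h2⟩
      · left
        simpa using h
      · right
        refine ⟨by simp [h], i, fun j hj => by simp [h1 j hj], by simpa using h2⟩

theorem RevLex.monotone {n : ℕ} : Monotone (toRevLex (n := n)) := by
  intro u v h
  rcases eq_or_ne u v with rfl | hne
  · exact le_rfl
  · refine le_of_lt (RevLex.lt_iff.2 (Or.inl ?_))
    obtain ⟨w, rfl⟩ := exists_add_of_le h
    have : w.degree ≠ 0 := by
      intro h0
      exact hne (by simp [(Finsupp.degree_eq_zero_iff w).1 h0])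
    rw [map_add]
    omega

instance (n : ℕ) : WellFoundedLT (RevLex n) := by
  refine ⟨RelEmbedding.wellFounded_iff_isEmpty.2 ⟨fun f => ?_⟩⟩
  obtain ⟨i, j, hij, h⟩ := wellQuasiOrdered_le (fun i => toRevLex.symm (f i))
  exact absurd (RevLex.monotone h) (not_le.2 (f.map_rel_iff.2 hij))

/-- The graded reverse lexicographic order with `x_1 > x_2 > ... > x_n`. -/
def degRevLex (n : ℕ) : MonomialOrder (Fin n) where
  syn := RevLex n
  toSyn := toRevLex
  toSyn_monotone := RevLex.monotone

/-! ### Generic initial ideals -/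

variable {k : Type*} [Field k] {n : ℕ}

/-- The initial ideal with respect to the graded reverse lexicographic order. -/
def initialIdeal (I : Ideal (MvPolynomial (Fin n) k)) : Ideal (MvPolynomial (Fin n) k) :=
  Ideal.span {p | ∃ f ∈ I, f ≠ 0 ∧ p = monomial ((degRevLex n).degree f) 1}

/-- The linear change of coordinates `x_j ↦ ∑ i, α i j • x_i` of the polynomial ring. -/
def coordChange (α : GL (Fin n) k) : MvPolynomial (Fin n) k →ₐ[k] MvPolynomial (Fin n) k :=
  aeval fun j => ∑ i, C ((α : Matrix (Fin n) (Fin n) k) i j) * X i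

/-- `U` is open in the Zariski topology of `GL_n(k)`: it is the locus where not all members of
some family of polynomials in the matrix entries vanish. -/
def IsZariskiOpen (U : Set (GL (Fin n) k)) : Prop :=
  ∃ T : Set (MvPolynomial (Fin n × Fin n) k),
    U = {α : GL (Fin n) k | ∃ F ∈ T, eval (fun p => (α : Matrix (Fin n) (Fin n) k) p.1 p.2) F ≠ 0}

/-- `J` is the common initial ideal of `α(I)` for all `α` in a nonempty Zariski open set. -/
def IsGin (I J : Ideal (MvPolynomial (Fin n) k)) : Prop :=
  ∃ U : Set (GL (Fin n) k), IsZariskiOpen U ∧ U.Nonempty ∧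
    ∀ α ∈ U, initialIdeal (I.map (coordChange α)) = J

open Classical in
/-- The generic initial ideal. Over an infinite field exactly one `J` satisfies `IsGin I J`. -/
def gin (I : Ideal (MvPolynomial (Fin n) k)) : Ideal (MvPolynomial (Fin n) k) :=
  if h : ∃ J, IsGin I J then h.choose else ⊥

/-! ### Monomial ideals -/

/-- The exponents of the monomials that are minimal generators of a monomial ideal `J`: the
monomials of `J` that are minimal under divisibility. -/
def minGens (J : Ideal (MvPolynomial (Fin n) k)) : Set (Fin n →₀ ℕ) :=
  {u | Minimal (fun v => monomial v (1 : k) ∈ J) u}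

/-- `Φ_r(J)`: in every minimal monomial generator of `J`, set `x_{r+1}, ..., x_n` to `1`. -/
def Phi (r : ℕ) (J : Ideal (MvPolynomial (Fin n) k)) : Ideal (MvPolynomial (Fin n) k) :=
  Ideal.span {p | ∃ u ∈ minGens J, p = monomial (u.filter fun i : Fin n => (i : ℕ) < r) 1}

/-- `Π_r : S → S(r)`, which sets `x_{r+1}, ..., x_n` to `0` and keeps `x_1, ..., x_r`. -/
def piHom (k : Type*) [Field k] (n r : ℕ) : MvPolynomial (Fin n) k →ₐ[k] MvPolynomial (Fin r) k :=
  aeval fun i => if h : (i : ℕ) < r then X ⟨i, h⟩ else 0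

/-! ### Homogeneous ideals, Hilbert series, multiplicity, depth -/

attribute [local instance] MvPolynomial.gradedAlgebra in
/-- `I` is homogeneous for the standard grading, in which every variable has degree `1`. -/
def IsHomogeneousIdeal (I : Ideal (MvPolynomial (Fin n) k)) : Prop :=
  I.IsHomogeneous (homogeneousSubmodule (Fin n) k)

/-- The Krull dimension of `S/I` as a natural number (`0` for the zero ring). -/
def dimQuot (I : Ideal (MvPolynomial (Fin n) k)) : ℕ :=
  ((ringKrullDim (MvPolynomial (Fin n) k ⧸ I)).unbotD 0).toNat

/-- The Hilbert function of `S/I` for a homogeneous ideal `I`: the dimension of the degree `m`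
component of `S/I`, which is the image of the forms of degree `m`. -/
def hilbertFunction (I : Ideal (MvPolynomial (Fin n) k)) (m : ℕ) : ℕ :=
  Module.finrank k
    ((homogeneousSubmodule (Fin n) k m).map (Ideal.Quotient.mkₐ k I).toLinearMap)

/-- The Hilbert series of `S/I`. -/
def hilbertSeries (I : Ideal (MvPolynomial (Fin n) k)) : PowerSeries ℤ :=
  PowerSeries.mk fun m => (hilbertFunction I m : ℤ)

open Classical in
/-- The polynomial `q` with Hilbert series `q(t) / (1 - t) ^ dim (S/I)`; it exists for every
homogeneous ideal. -/
def hilbertNumerator (I : Ideal (MvPolynomial (Fin n) k)) : Polynomial ℤ :=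
  if h : ∃ q : Polynomial ℤ,
      (q : PowerSeries ℤ) = hilbertSeries I * (1 - PowerSeries.X) ^ dimQuot I
  then h.choose else 0

/-- The degree (multiplicity) `deg (S/I)`, the Hilbert coefficient `e_0 = q(1)`. -/
def deg (I : Ideal (MvPolynomial (Fin n) k)) : ℤ :=
  (hilbertNumerator I).eval 1

/-- The depth of `S/I` with respect to the maximal homogeneous ideal `(x_1, ..., x_n)`: the
supremum of the lengths of regular sequences on `S/I` inside that ideal. -/
def depthQuot (I : Ideal (MvPolynomial (Fin n) k)) : ℕ∞ :=
  ⨆ rs : {rs : List (MvPolynomial (Fin n) k) //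
      (∀ f ∈ rs, f ∈ idealOfVars (Fin n) k) ∧
        RingTheory.Sequence.IsRegular (MvPolynomial (Fin n) k ⧸ I) rs},
    (rs.1.length : ℕ∞)

/-- The standard graded algebra `S/I` is almost Cohen–Macaulay: `dim ≤ depth + 1`. -/
def IsAlmostCohenMacaulay (I : Ideal (MvPolynomial (Fin n) k)) : Prop :=
  ringKrullDim (MvPolynomial (Fin n) k ⧸ I) ≤ ((depthQuot I + 1 : ℕ∞) : WithBot ℕ∞)

end GinDepth

end

noncomputable section

namespace GinDepth

/-! ### Krull dimension of integral extensions -/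

/-! Fix coordinates `α` in the open set defining the generic initial ideal. Put `Q = α(P)` and `A =
k[x_{c+1}, ..., x_n]`, and call a monomial low if it involves only `x_1, ..., x_c`, standard if it
lies outside `J`. Generically `A` is a Noether normalization of `S/Q` (`noether_position`), so there
are finitely many low standard monomials. Both degrees count low monomials: that of `Π_c(J)` counts
the standard ones, that of `Φ_c(J)` those with no multiple by a monomial of `A` in `J`
(`deg_map_piHom`, `deg_Phi`). The hypothesis therefore says that exactly one low standard monomial
`u` has a multiple by a monomial of `A` in `J` (`exists_unique_low`).

The low standard monomials generate `S/Q` over `A`; consider the `A`-module of relations between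
them. The leading monomial of a nonzero relation has low part `u`, so a relation is determined by
its coefficient at `u`, and the module has rank one. As `P` is prime, `S/Q` is torsion-free over the
factorial ring `A`, and the module of relations is free (`exists_generating_relation`). Hence the
monomials of `J` with standard low part are multiples of a single `u * m`, with `m` a monomial of
`A`. A generic shear of `x_{c+1}, ..., x_n` leaves `J` unchanged and gives the coefficient at `u` a
power of `x_{c+1}` as leading monomial, so `m = x_{c+1}^e` (`exists_generic_shear`,
`exists_generator_shape`). So `J` is generated in the first `c + 1` variables, and `u * x_{c+1}^e`
is a minimal generator.

For the depth, the reverse lexicographic order is compatible with setting the last variables to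
zero. The variables `x_n, ..., x_{c+2}` can be cancelled from monomials of `J`, hence form a regular
sequence on `S/Q` (`regularMod_X`). Modulo them some element with leading monomial `u *
x_{c+1}^(e-1)` is nonzero and killed by `x_{c+1}`; by Noether position this yields a nonzero socle
(`hasSocle_of_shape`). A regular sequence ending in a nonzero socle has the largest possible length
(`HasMaximalRegularSequence.length_le`), so the depth is `n - (c + 1) = d - 1`. -/

theorem ringKrullDim_eq_of_isIntegral_of_injective {R A : Type*} [CommRing R] [CommRing A]
    [Algebra R A] [Algebra.IsIntegral R A] (hinj : Function.Injective (algebraMap R A)) :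
    ringKrullDim A = ringKrullDim R := by
  refine le_antisymm ?_ ?_
  · refine Order.krullDim_le_of_strictMono (PrimeSpectrum.comap (algebraMap R A)) ?_
    intro p q hpq
    exact Ideal.IsIntegral.comap_lt_comap (R := R) (I := p.asIdeal) (J := q.asIdeal) hpq
  · refine iSup_le fun l => ?_
    obtain ⟨P, -, hP, hPl⟩ := Ideal.exists_ideal_over_prime_of_isIntegral (S := A)
      (RelSeries.head l).asIdeal ⊥ (by
        rw [← RingHom.ker_eq_comap_bot, (RingHom.injective_iff_ker_eq_bot _).1 hinj]
        exact bot_le)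
    have : P.LiesOver (RelSeries.head l).asIdeal := ⟨hPl.symm⟩
    obtain ⟨L, hL, -, -⟩ := Ideal.exists_ltSeries_of_hasGoingUp l P
    rw [← hL]
    exact Order.LTSeries.length_le_krullDim L

/-! ### Depth with respect to a maximal ideal -/

section Depth

variable {S : Type*} [CommRing S]

/-- `f` is a nonzerodivisor modulo the ideal `I`. -/
def RegularMod (I : Ideal S) (f : S) : Prop := ∀ a, f * a ∈ I → a ∈ I

/-- The socle of `S/I` with respect to `m` is nonzero. -/
def HasSocle (m I : Ideal S) : Prop := ∃ z, z ∉ I ∧ ∀ a ∈ m, a * z ∈ I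

/-- Some regular sequence in `m` on `S/I` of length `t` has a quotient with nonzero socle. -/
def HasMaximalRegularSequence (m : Ideal S) : ℕ → Ideal S → Prop
  | 0, I => HasSocle m I
  | t + 1, I => ∃ y ∈ m, RegularMod I y ∧ HasMaximalRegularSequence m t (I ⊔ Ideal.span {y})

theorem mem_sup_span_singleton {I : Ideal S} {y a : S} :
    a ∈ I ⊔ Ideal.span {y} ↔ ∃ b, a - y * b ∈ I := by
  rw [Submodule.mem_sup]
  constructor
  · rintro ⟨i, hi, j, hj, rfl⟩
    obtain ⟨b, rfl⟩ := Ideal.mem_span_singleton'.1 hj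
    exact ⟨b, by simpa [mul_comm] using hi⟩
  · rintro ⟨b, hb⟩
    exact ⟨_, hb, y * b, Ideal.mem_span_singleton'.2 ⟨b, mul_comm _ _⟩, by ring⟩

theorem HasSocle.not_regularMod {m I : Ideal S} (h : HasSocle m I) {f : S} (hf : f ∈ m) :
    ¬ RegularMod I f := by
  obtain ⟨z, hz, hm⟩ := h
  exact fun hr => hz (hr z (hm f hf))

/-- A nonzero socle is passed from one quotient by a regular element to any other. -/
theorem HasSocle.exchange {m I : Ideal S} {x y : S} (hy : y ∈ m)
    (rx : RegularMod I x) (ry : RegularMod I y) (h : HasSocle m (I ⊔ Ideal.span {x})) :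
    HasSocle m (I ⊔ Ideal.span {y}) := by
  obtain ⟨z, hz, hm⟩ := h
  -- The new socle element is the `w` with `y z = x w` modulo `I`: cancelling `y` shows that `w` is
  -- nonzero modulo `y`, cancelling `x` that `m` kills it there.
  obtain ⟨w, hw⟩ := mem_sup_span_singleton.1 (hm y hy)
  refine ⟨w, fun hwy => hz ?_, fun a ha => ?_⟩
  · obtain ⟨v, hv⟩ := mem_sup_span_singleton.1 hwy
    refine mem_sup_span_singleton.2 ⟨v, ry _ ?_⟩
    have := I.add_mem hw (I.mul_mem_left x hv)
    convert this using 1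
    ring
  · obtain ⟨z', hz'⟩ := mem_sup_span_singleton.1 (hm a ha)
    refine mem_sup_span_singleton.2 ⟨z', rx _ ?_⟩
    have := I.sub_mem (I.mul_mem_left y hz') (I.mul_mem_left a hw)
    convert this using 1
    ring

/-- Needs no locality: if `y b = z a` modulo `I`, then `a` is a multiple of `y` modulo `I`, and `y`
cancels. -/
theorem RegularMod.swap {I : Ideal S} {y z : S} (ry : RegularMod I y)
    (rz : RegularMod (I ⊔ Ideal.span {y}) z) : RegularMod (I ⊔ Ideal.span {z}) y := by
  intro b hb
  obtain ⟨a, ha⟩ := mem_sup_span_singleton.1 hb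
  have h1 : z * a ∈ I ⊔ Ideal.span {y} :=
    mem_sup_span_singleton.2 ⟨b, by simpa using I.neg_mem ha⟩
  obtain ⟨a', ha'⟩ := mem_sup_span_singleton.1 (rz a h1)
  refine mem_sup_span_singleton.2 ⟨a', ry _ ?_⟩
  have := I.add_mem ha (I.mul_mem_left z ha')
  convert this using 1
  ring

theorem regularMod_iff_isSMulRegular {I : Ideal S} {f : S} :
    RegularMod I f ↔ IsSMulRegular (S ⧸ I) f :=
  (isSMulRegular_quotient_iff_mem_of_smul_mem I f).symm

theorem hasSocle_of_mem_associatedPrimes [IsNoetherianRing S] {m I p : Ideal S}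
    (hp : p ∈ associatedPrimes S (S ⧸ I)) (h : m ≤ p) : HasSocle m I := by
  obtain ⟨hprime, x, hx⟩ := isAssociatedPrime_iff.1 (AssociatedPrimes.mem_iff.1 hp)
  obtain ⟨z, rfl⟩ := Ideal.Quotient.mk_surjective x
  have key : ∀ a, a ∈ p ↔ a * z ∈ I := by
    intro a
    rw [hx, Submodule.mem_colon_singleton, Submodule.mem_bot, ← Ideal.Quotient.eq_zero_iff_mem]
    rfl
  refine ⟨z, fun hz => hprime.ne_top ((Ideal.eq_top_iff_one _).2 ((key 1).2 (by simpa using hz))),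
    fun a ha => (key a).1 (h ha)⟩

/-- An element of `S/I` annihilated by a power of `m` gives rise to a nonzero socle. -/
theorem hasSocle_of_le_radical [IsNoetherianRing S] {m I K : Ideal S} {z : S} (hz : z ∉ I)
    (hK : ∀ a ∈ K, a * z ∈ I) (hm : m ≤ K.radical) : HasSocle m I := by
  obtain ⟨p, hp, hle⟩ := exists_le_isAssociatedPrime_of_isNoetherianRing S
    (Ideal.Quotient.mk I z) (by rwa [Ne, Ideal.Quotient.eq_zero_iff_mem])
  refine hasSocle_of_mem_associatedPrimes hp (hm.trans ?_)
  refine (Ideal.IsPrime.radical_le_iff hp.isPrime).2 fun a ha => hle ?_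
  rw [Submodule.mem_colon_singleton, Submodule.mem_bot]
  exact Ideal.Quotient.eq_zero_iff_mem.2 (hK a ha)

/-- Prime avoidance for the associated primes of all the quotients at once, none of which contains
`m`. -/
theorem exists_regularMod_of_not_hasSocle [IsNoetherianRing S] {m : Ideal S}
    (s : Finset (Ideal S)) (hs : ∀ I ∈ s, ¬ HasSocle m I) :
    ∃ z ∈ m, ∀ I ∈ s, RegularMod I z := by
  by_contra! h
  let T : Set (Ideal S) := ⋃ I ∈ s, associatedPrimes S (S ⧸ I)
  have hT : T.Finite := s.finite_toSet.biUnion fun I _ => associatedPrimes.finite S (S ⧸ I)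
  have hsub : (m : Set S) ⊆ ⋃ p ∈ T, (p : Set S) := by
    intro z hz
    obtain ⟨I, hI, hr⟩ := h z hz
    rw [regularMod_iff_isSMulRegular] at hr
    have h2 : z ∈ ⋃ p ∈ associatedPrimes S (S ⧸ I), (p : Set S) := by
      rw [biUnion_associatedPrimes_eq_compl_regular]
      exact hr
    obtain ⟨p, hp, hzp⟩ := Set.mem_iUnion₂.1 h2
    exact Set.mem_iUnion₂.2 ⟨p, Set.mem_iUnion₂.2 ⟨I, hI, hp⟩, hzp⟩
  obtain ⟨p, hp, hmp⟩ := (Ideal.subset_union_prime_finite hT (f := fun p => p) ⊤ ⊤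
    (fun p hp _ _ => by
      obtain ⟨I, -, hp⟩ := Set.mem_iUnion₂.1 hp
      exact IsAssociatedPrime.isPrime hp)).1 hsub
  obtain ⟨I, hI, hp⟩ := Set.mem_iUnion₂.1 hp
  exact hs I hI (hasSocle_of_mem_associatedPrimes hp hmp)

/-- Invariance of the length: any regular `f` may take the place of the first element. For `t = 0`
this is the exchange of socles. Otherwise some `z` is regular modulo `I`, `I + (y)` and `I + (f)`,
and two applications of the induction hypothesis replace `y` by `z` and then `z` by `f`. -/
theorem HasMaximalRegularSequence.quotient [IsNoetherianRing S] {m : Ideal S} (t : ℕ) :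
    ∀ {I : Ideal S} {f : S}, f ∈ m → RegularMod I f → HasMaximalRegularSequence m (t + 1) I →
      HasMaximalRegularSequence m t (I ⊔ Ideal.span {f}) := by
  induction t with
  | zero =>
    rintro I f hf rf ⟨y, hy, ry, h⟩
    exact HasSocle.exchange hf ry rf h
  | succ t ih =>
    rintro I f hf rf ⟨y, hy, ry, h⟩
    have hIy : ¬ HasSocle m (I ⊔ Ideal.span {y}) := fun hs => by
      obtain ⟨y', hy', ry', -⟩ := h
      exact hs.not_regularMod hy' ry'
    have hIf : ¬ HasSocle m (I ⊔ Ideal.span {f}) := fun hs => hIy (hs.exchange hy rf ry)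
    classical
    obtain ⟨z, hz, hr⟩ := exists_regularMod_of_not_hasSocle (m := m)
      {I, I ⊔ Ideal.span {y}, I ⊔ Ideal.span {f}} (by
        intro K hK
        simp only [Finset.mem_insert, Finset.mem_singleton] at hK
        rcases hK with rfl | rfl | rfl
        · exact fun hs => hs.not_regularMod hf rf
        · exact hIy
        · exact hIf)
    have rzI : RegularMod I z := hr _ (by simp)
    have rzy : RegularMod (I ⊔ Ideal.span {y}) z := hr _ (by simp)
    have rzf : RegularMod (I ⊔ Ideal.span {f}) z := hr _ (by simp)
    have h1 : HasMaximalRegularSequence m (t + 1) (I ⊔ Ideal.span {z}) := by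
      refine ⟨y, hy, ry.swap rzy, ?_⟩
      rw [sup_right_comm]
      exact ih hz rzy h
    refine ⟨z, hz, rzf, ?_⟩
    rw [sup_right_comm]
    exact ih hf (rf.swap rzf) h1

open scoped Pointwise in
theorem isWeaklyRegular_quotient_cons_iff {I : Ideal S} {f : S} {fs : List S} :
    RingTheory.Sequence.IsWeaklyRegular (S ⧸ I) (f :: fs) ↔
      RegularMod I f ∧ RingTheory.Sequence.IsWeaklyRegular (S ⧸ (I ⊔ Ideal.span {f})) fs := by
  rw [RingTheory.Sequence.isWeaklyRegular_cons_iff, regularMod_iff_isSMulRegular]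
  refine and_congr Iff.rfl (LinearEquiv.isWeaklyRegular_congr ?_ fs)
  have h2 : Submodule.map (Submodule.mkQ I) (I ⊔ Ideal.span {f}) =
      f • (⊤ : Submodule S (S ⧸ I)) := by
    rw [Submodule.map_sup, ← Submodule.ideal_span_singleton_smul]
    rw [show Submodule.map (Submodule.mkQ I) I = ⊥ by
      simp, bot_sup_eq]
    rw [← Submodule.range_mkQ I, ← Submodule.map_top, ← Submodule.map_smul'']
    simp
  exact (Submodule.quotEquivOfEq _ _ h2.symm).trans
    (Submodule.quotientQuotientEquivQuotient I (I ⊔ Ideal.span {f}) le_sup_left)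

/-- Each member of a regular sequence in `m` lowers `t` by one, and a nonzero socle admits no
further member. -/
theorem HasMaximalRegularSequence.length_le [IsNoetherianRing S] {m : Ideal S} :
    ∀ (fs : List S) {t : ℕ} {I : Ideal S}, HasMaximalRegularSequence m t I →
      (∀ f ∈ fs, f ∈ m) → RingTheory.Sequence.IsWeaklyRegular (S ⧸ I) fs → fs.length ≤ t
  | [], _, _, _, _, _ => Nat.zero_le _
  | f :: fs, 0, I, h, hm, hr =>
    absurd (isWeaklyRegular_quotient_cons_iff.1 hr).1
      (HasSocle.not_regularMod h (hm f List.mem_cons_self))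
  | f :: fs, t + 1, I, h, hm, hr => by
    obtain ⟨rf, hr⟩ := isWeaklyRegular_quotient_cons_iff.1 hr
    have := HasMaximalRegularSequence.length_le fs
      (HasMaximalRegularSequence.quotient t (hm f List.mem_cons_self) rf h)
      (fun g hg => hm g (List.mem_cons_of_mem _ hg)) hr
    simpa using this

theorem HasMaximalRegularSequence.exists_isWeaklyRegular {m : Ideal S} :
    ∀ {t : ℕ} {I : Ideal S}, HasMaximalRegularSequence m t I →
      ∃ fs : List S, fs.length = t ∧ (∀ f ∈ fs, f ∈ m) ∧
        RingTheory.Sequence.IsWeaklyRegular (S ⧸ I) fs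
  | 0, _, _ => ⟨[], rfl, by simp, by simp⟩
  | _ + 1, _, ⟨y, hy, ry, h⟩ => by
    obtain ⟨fs, h1, h2, h3⟩ := HasMaximalRegularSequence.exists_isWeaklyRegular h
    refine ⟨y :: fs, by simp [h1], ?_, isWeaklyRegular_quotient_cons_iff.2 ⟨ry, h3⟩⟩
    intro f hf
    rcases List.mem_cons.1 hf with rfl | hf
    exacts [hy, h2 f hf]

theorem HasMaximalRegularSequence.map_equiv {S' : Type*} [CommRing S'] (e : S ≃+* S')
    {m : Ideal S} {m' : Ideal S'} (hm : ∀ a, a ∈ m ↔ e a ∈ m') :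
    ∀ {t : ℕ} {I : Ideal S}, HasMaximalRegularSequence m t I →
      HasMaximalRegularSequence m' t (I.map e)
  | 0, I, ⟨z, hz, h⟩ => by
    refine ⟨e z, by rwa [Ideal.apply_mem_of_equiv_iff], fun a ha => ?_⟩
    obtain ⟨a, rfl⟩ := e.surjective a
    rw [← map_mul, Ideal.apply_mem_of_equiv_iff]
    exact h a ((hm a).2 ha)
  | t + 1, I, ⟨y, hy, ry, h⟩ => by
    refine ⟨e y, (hm y).1 hy, fun a ha => ?_, ?_⟩
    · obtain ⟨a, rfl⟩ := e.surjective a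
      rw [← map_mul, Ideal.apply_mem_of_equiv_iff] at ha
      rw [Ideal.apply_mem_of_equiv_iff]
      exact ry a ha
    · have := HasMaximalRegularSequence.map_equiv e hm h
      rw [Ideal.map_sup, Ideal.map_span, Set.image_singleton] at this
      exact this

end Depth

section DepthQuot

variable {k : Type*} [Field k] {n : ℕ}

theorem mem_idealOfVars_iff {f : MvPolynomial (Fin n) k} :
    f ∈ MvPolynomial.idealOfVars (Fin n) k ↔ MvPolynomial.coeff 0 f = 0 := by
  rw [← pow_one (MvPolynomial.idealOfVars (Fin n) k), MvPolynomial.mem_pow_idealOfVars_iff']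
  simp [Finsupp.degree_eq_zero_iff]

theorem depthQuot_eq_of_hasMaximalRegularSequence {I : Ideal (MvPolynomial (Fin n) k)}
    (hI : I ≤ MvPolynomial.idealOfVars (Fin n) k) {t : ℕ}
    (h : HasMaximalRegularSequence (MvPolynomial.idealOfVars (Fin n) k) t I) :
    depthQuot I = t := by
  refine le_antisymm (iSup_le fun rs => ?_) ?_
  · exact_mod_cast h.length_le rs.1 rs.2.1 rs.2.2.toIsWeaklyRegular
  · obtain ⟨fs, hl, hm, hr⟩ := h.exists_isWeaklyRegular
    refine le_iSup_of_le ⟨fs, hm, hr, ?_⟩ (by simp [hl])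
    intro htop
    have hle : Ideal.ofList fs ≤ MvPolynomial.idealOfVars (Fin n) k := Ideal.span_le.2 hm
    have h1 : (Ideal.Quotient.mk I 1) ∈
        Submodule.map (Submodule.mkQ I) (MvPolynomial.idealOfVars (Fin n) k) := by
      have : (Ideal.Quotient.mk I 1) ∈ (⊤ : Submodule (MvPolynomial (Fin n) k)
          (MvPolynomial (Fin n) k ⧸ I)) := trivial
      rw [htop, ← Submodule.range_mkQ I, ← Submodule.map_top, ← Submodule.map_smul''] at this
      refine Submodule.map_mono ?_ this
      simpa using hle
    obtain ⟨a, ha, hab⟩ := h1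
    have h2 : a - 1 ∈ I := Ideal.Quotient.eq.1 hab
    have h3 := (MvPolynomial.idealOfVars (Fin n) k).sub_mem ha (hI h2)
    rw [sub_sub_cancel] at h3
    rw [mem_idealOfVars_iff] at h3
    simp at h3

end DepthQuot

/-! ### Leading exponents and initial ideals -/

section InitialIdeal

variable {k : Type*} [Field k] {n : ℕ}

/-- The exponents of the leading monomials of the nonzero elements of `I`. -/
def leadExps (I : Ideal (MvPolynomial (Fin n) k)) : Set (Fin n →₀ ℕ) :=
  {w | ∃ f ∈ I, f ≠ 0 ∧ (degRevLex n).degree f = w}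

theorem isUpperSet_leadExps (I : Ideal (MvPolynomial (Fin n) k)) : IsUpperSet (leadExps I) := by
  rintro _ w hle ⟨f, hf, h0, rfl⟩
  obtain ⟨v, rfl⟩ := exists_add_of_le hle
  have hm : monomial v (1 : k) ≠ 0 := by simp
  refine ⟨f * monomial v 1, I.mul_mem_right _ hf, mul_ne_zero h0 hm, ?_⟩
  classical
  rw [MonomialOrder.degree_mul h0 hm, MonomialOrder.degree_monomial, if_neg one_ne_zero]

theorem mem_span_monomial_iff {E : Set (Fin n →₀ ℕ)} (hE : IsUpperSet E)
    {f : MvPolynomial (Fin n) k} :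
    f ∈ Ideal.span ((fun w => monomial w (1 : k)) '' E) ↔ ∀ w ∈ f.support, w ∈ E := by
  rw [mem_ideal_span_monomial_image]
  exact forall₂_congr fun w _ => ⟨fun ⟨v, hv, h⟩ => hE h hv, fun h => ⟨w, h, le_rfl⟩⟩

theorem monomial_mem_span_monomial_iff {E : Set (Fin n →₀ ℕ)} (hE : IsUpperSet E)
    {w : Fin n →₀ ℕ} :
    monomial w (1 : k) ∈ Ideal.span ((fun w => monomial w (1 : k)) '' E) ↔ w ∈ E := by
  classical
  rw [mem_span_monomial_iff hE, support_monomial, if_neg one_ne_zero]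
  simp

theorem initialIdeal_eq_span (I : Ideal (MvPolynomial (Fin n) k)) :
    initialIdeal I = Ideal.span ((fun w => monomial w (1 : k)) '' leadExps I) := by
  rw [initialIdeal]
  congr 1
  ext p
  constructor
  · rintro ⟨f, hf, h0, rfl⟩
    exact ⟨_, ⟨f, hf, h0, rfl⟩, rfl⟩
  · rintro ⟨_, ⟨f, hf, h0, rfl⟩, rfl⟩
    exact ⟨f, hf, h0, rfl⟩

theorem monomial_mem_initialIdeal_iff {I : Ideal (MvPolynomial (Fin n) k)} {w : Fin n →₀ ℕ} :
    monomial w (1 : k) ∈ initialIdeal I ↔ w ∈ leadExps I := by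
  rw [initialIdeal_eq_span, monomial_mem_span_monomial_iff (isUpperSet_leadExps I)]

theorem leadExps_eq_of_initialIdeal_eq {I I' : Ideal (MvPolynomial (Fin n) k)}
    (h : initialIdeal I = initialIdeal I') : leadExps I = leadExps I' := by
  ext w
  rw [← monomial_mem_initialIdeal_iff, h, monomial_mem_initialIdeal_iff]

/-- Reduction modulo `I` to a polynomial none of whose monomials belongs to a given set of leading
monomials of `I`. -/
theorem exists_reduction {I : Ideal (MvPolynomial (Fin n) k)} {D : Set (Fin n →₀ ℕ)}
    (hD : D ⊆ leadExps I) (f : MvPolynomial (Fin n) k) :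
    ∃ g, f - g ∈ I ∧ (∀ w ∈ g.support, w ∉ D) ∧
      toRevLex ((degRevLex n).degree g) ≤ toRevLex ((degRevLex n).degree f) := by
  let B : Set (MvPolynomial (Fin n) k) := {b | b ∈ I ∧ b ≠ 0 ∧ (degRevLex n).degree b ∈ D}
  obtain ⟨q, g, h1, h2, h3⟩ := MonomialOrder.div_set (m := degRevLex n) (B := B)
    (fun b hb => (MonomialOrder.leadingCoeff_ne_zero_iff.2 hb.2.1).isUnit) f
  refine ⟨g, ?_, fun w hw hwD => ?_, ?_⟩
  · rw [h1, add_sub_cancel_right, Finsupp.linearCombination_apply]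
    exact Ideal.sum_mem _ fun b _ => I.mul_mem_left _ b.2.1
  · obtain ⟨b, hb, hb0, rfl⟩ := hD hwD
    exact h3 _ hw b ⟨hb, hb0, hwD⟩ le_rfl
  · have : g = f - Finsupp.linearCombination _ (fun b : B => (b : MvPolynomial (Fin n) k)) q := by
      rw [h1]; ring
    rw [this]
    refine (MonomialOrder.degree_sub_le (m := degRevLex n)).trans (sup_le le_rfl ?_)
    rw [Finsupp.linearCombination_apply]
    refine (MonomialOrder.degree_sum_le (m := degRevLex n)).trans (Finset.sup_le fun b _ => ?_)
    simpa [mul_comm] using! h2 b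

/-- Only the tail behind the leading term is reduced. Its remainder stays below the leading term, so
the leading exponent survives. -/
theorem exists_reduced_of_mem_leadExps {I : Ideal (MvPolynomial (Fin n) k)}
    {D : Set (Fin n →₀ ℕ)} (hD : D ⊆ leadExps I) {w : Fin n →₀ ℕ} (hw : w ∈ leadExps I)
    (hwD : w ∉ D) :
    ∃ g ∈ I, g ≠ 0 ∧ (degRevLex n).degree g = w ∧ ∀ v ∈ g.support, v ∉ D := by
  classical
  obtain ⟨f, hf, h0, rfl⟩ := hw
  set l := (degRevLex n).leadingTerm f
  obtain ⟨g', h1, h2, h3⟩ := exists_reduction hD (f - l)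
  have hl : (degRevLex n).degree l = (degRevLex n).degree f := MonomialOrder.degree_leadingTerm _
  by_cases hfl : f - l = 0
  · refine ⟨f, hf, h0, rfl, fun v hv => ?_⟩
    rw [sub_eq_zero.1 hfl, MonomialOrder.support_leadingTerm' h0, Finset.mem_singleton] at hv
    rwa [hv]
  have hlt : toRevLex ((degRevLex n).degree (f - l)) < toRevLex ((degRevLex n).degree f) := by
    refine MonomialOrder.degree_sub_LTerm_lt (m := degRevLex n) fun h => hfl ?_
    have hC := MonomialOrder.eq_C_of_degree_eq_zero h
    rw [sub_eq_zero]
    change f = (degRevLex n).leadingTerm f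
    rw [hC, MonomialOrder.leadingTerm_C]
  have hlt' := h3.trans_lt hlt
  have hdeg : (degRevLex n).degree (l + g') = (degRevLex n).degree f := by
    rw [MonomialOrder.degree_add_of_lt, hl]
    rw [hl]
    exact hlt'
  refine ⟨l + g', ?_, ?_, hdeg, fun v hv => ?_⟩
  · have := I.sub_mem hf h1
    convert this using 1
    ring
  · intro h
    rw [h] at hdeg
    rw [← hdeg] at hlt'
    exact absurd hlt' (not_lt.2 (by simpa using RevLex.monotone (zero_le (a := (degRevLex n).degree g'))))
  · rcases Finset.mem_union.1 (support_add hv) with hv | hv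
    · rw [MonomialOrder.support_leadingTerm' h0, Finset.mem_singleton] at hv
      rwa [hv]
    · exact h2 v hv

end InitialIdeal

/-! ### Separating the variables -/

section Split

variable (k : Type*) [Field k] (n r : ℕ)

/-- The first `r` variables. -/
abbrev LowVar : Type := {i : Fin n // (i : ℕ) < r}

/-- The variables after the first `r`. -/
abbrev HighVar : Type := {i : Fin n // ¬ (i : ℕ) < r}

/-- Polynomials as polynomials in the first `r` variables over the ring of polynomials in the
others. -/
def split : MvPolynomial (Fin n) k ≃ₐ[k] MvPolynomial (LowVar n r) (MvPolynomial (HighVar n r) k) :=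
  (renameEquiv k (Equiv.sumCompl fun i : Fin n => (i : ℕ) < r).symm).trans (sumAlgEquiv k _ _)

/-- The inclusion of the ring of polynomials in the variables after the first `r`. -/
def highIncl : MvPolynomial (HighVar n r) k →ₐ[k] MvPolynomial (Fin n) k := rename Subtype.val

variable {k n r}

/-- The part of an exponent vector that belongs to the first `r` variables. -/
abbrev low (r : ℕ) (w : Fin n →₀ ℕ) : LowVar n r →₀ ℕ := w.subtypeDomain _

/-- The part of an exponent vector that belongs to the variables after the first `r`. -/
abbrev high (r : ℕ) (w : Fin n →₀ ℕ) : HighVar n r →₀ ℕ := w.subtypeDomain _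

theorem split_X_low (i : LowVar n r) : split k n r (X i.1) = X i := by
  simp [split]

theorem split_X_high (i : HighVar n r) : split k n r (X i.1) = C (X i) := by
  simp [split]

theorem split_highIncl (g : MvPolynomial (HighVar n r) k) :
    split k n r (highIncl k n r g) = C g := by
  have : ((split k n r).toAlgHom.comp (highIncl k n r)) =
      IsScalarTower.toAlgHom k (MvPolynomial (HighVar n r) k) _ := by
    ext i : 1
    simp [highIncl, split_X_high, algebraMap_eq]
  exact DFunLike.congr_fun this g

theorem split_monomial (w : Fin n →₀ ℕ) (a : k) :
    split k n r (monomial w a) = monomial (low r w) (monomial (high r w) a) := by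
  rw [monomial_eq, monomial_eq, monomial_eq, map_mul, Finsupp.prod_fintype _ _ (by simp),
    Finsupp.prod_fintype _ _ (by simp), Finsupp.prod_fintype _ _ (by simp), map_prod,
    ← Fintype.prod_subtype_mul_prod_subtype (fun i : Fin n => (i : ℕ) < r)]
  simp only [map_pow, split_X_low, split_X_high, map_mul, map_prod, Finsupp.subtypeDomain_apply]
  have : split k n r (C a) = C (C a) := by
    simpa [highIncl] using split_highIncl (k := k) (n := n) (r := r) (C a)
  rw [this]
  ring

theorem coeff_split (f : MvPolynomial (Fin n) k) (w : Fin n →₀ ℕ) :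
    coeff (high r w) (coeff (low r w) (split k n r f)) = coeff w f := by
  classical
  induction f using MvPolynomial.induction_on' with
  | monomial v a =>
    have : low r v = low r w ∧ high r v = high r w ↔ v = w := by
      refine ⟨fun ⟨h1, h2⟩ => Finsupp.ext fun i => ?_, fun h => by simp [h]⟩
      by_cases hi : (i : ℕ) < r
      · exact DFunLike.congr_fun h1 ⟨i, hi⟩
      · exact DFunLike.congr_fun h2 ⟨i, hi⟩
    rw [split_monomial, coeff_monomial, coeff_monomial]
    split_ifs with h1 h2 h2
    · rw [coeff_monomial, if_pos (by rw [h2])]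
    · rw [coeff_monomial, if_neg (fun h => h2 (this.1 ⟨h1, h⟩))]
    · exact absurd (by rw [h2]) h1
    · simp
  | add p q hp hq => simp [hp, hq]

theorem exists_low_high (v : LowVar n r →₀ ℕ) (m : HighVar n r →₀ ℕ) :
    ∃ w : Fin n →₀ ℕ, low r w = v ∧ high r w = m := by
  refine ⟨Finsupp.equivFunOnFinite.symm fun i => if h : (i : ℕ) < r then v ⟨i, h⟩ else m ⟨i, h⟩,
    ?_, ?_⟩
  · ext i
    simp [i.2]
  · ext i
    simp [i.2]

end Split

/-! ### Standard monomials, dimension and degree -/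

section Dimension

variable {k : Type*} [Field k] {n : ℕ}

/-- The exponent vector with the entries after the first `r` replaced by zero. -/
abbrev cut (r : ℕ) (w : Fin n →₀ ℕ) : Fin n →₀ ℕ := w.filter fun i : Fin n => (i : ℕ) < r

theorem cut_apply_of_lt {r : ℕ} {i : Fin n} (hi : (i : ℕ) < r) (w : Fin n →₀ ℕ) :
    cut r w i = w i :=
  Finsupp.filter_apply_pos _ _ hi

theorem cut_apply_of_not_lt {r : ℕ} {i : Fin n} (hi : ¬ (i : ℕ) < r) (w : Fin n →₀ ℕ) :
    cut r w i = 0 :=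
  Finsupp.filter_apply_neg _ _ hi

theorem cut_le (r : ℕ) (w : Fin n →₀ ℕ) : cut r w ≤ w := by
  intro i
  rw [Finsupp.filter_apply]
  split_ifs <;> simp

theorem cut_cut (r : ℕ) (w : Fin n →₀ ℕ) : cut r (cut r w) = cut r w := by
  ext i
  simp only [Finsupp.filter_apply]
  split_ifs <;> rfl

theorem cut_zero (r : ℕ) : cut r (0 : Fin n →₀ ℕ) = 0 := by
  ext i
  simp [Finsupp.filter_apply]

theorem cut_single_of_lt {r : ℕ} {i : Fin n} (hi : (i : ℕ) < r) (N : ℕ) :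
    cut r (Finsupp.single i N) = Finsupp.single i N :=
  Finsupp.filter_single_of_pos (fun i : Fin n => (i : ℕ) < r) hi

theorem cut_eq_iff_low_eq {r : ℕ} {v w : Fin n →₀ ℕ} : cut r v = cut r w ↔ low r v = low r w := by
  constructor
  · intro h
    ext i
    simpa [i.2] using DFunLike.congr_fun h i.1
  · intro h
    ext i
    by_cases hi : (i : ℕ) < r
    · simpa [hi] using DFunLike.congr_fun h ⟨i, hi⟩
    · simp [hi]

theorem eq_of_low_eq_of_high_eq {r : ℕ} {v w : Fin n →₀ ℕ} (h1 : low r v = low r w)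
    (h2 : high r v = high r w) : v = w := by
  ext i
  by_cases hi : (i : ℕ) < r
  · exact DFunLike.congr_fun h1 ⟨i, hi⟩
  · exact DFunLike.congr_fun h2 ⟨i, hi⟩

theorem monomial_eq_highIncl_mul (r : ℕ) (w : Fin n →₀ ℕ) (a : k) :
    monomial w a = highIncl k n r (monomial (high r w) a) * monomial (cut r w) 1 := by
  apply (split k n r).injective
  rw [map_mul, split_highIncl, split_monomial, split_monomial, C_mul_monomial]
  have h1 : low r (cut r w) = low r w := cut_eq_iff_low_eq.1 (cut_cut r w)
  have h2 : high r (cut r w) = 0 := by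
    ext i
    simp [i.2]
  rw [h1, h2, monomial_mul, add_zero, mul_one]

/-- The exponents of the monomials in the first `r` variables that do not belong to `E`. -/
def lowStandard (r : ℕ) (E : Set (Fin n →₀ ℕ)) : Set (Fin n →₀ ℕ) :=
  {v | cut r v = v ∧ v ∉ E}

theorem lowStandard_finite {r : ℕ} {E : Set (Fin n →₀ ℕ)} (hE : IsUpperSet E)
    (h : ∀ i : Fin n, (i : ℕ) < r → ∃ N, Finsupp.single i N ∈ E) : (lowStandard r E).Finite := by
  choose! N hN using h
  refine (Set.finite_Iic (Finsupp.equivFunOnFinite.symm N)).subset ?_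
  rintro v ⟨hv, hvE⟩ i
  by_cases hi : (i : ℕ) < r
  · by_contra hlt
    refine hvE (hE ?_ (hN i hi))
    rw [Finsupp.single_le_iff]
    exact (not_le.1 hlt).le
  · rw [← hv]
    simp [hi]

theorem card_highVar {r : ℕ} (hr : r ≤ n) : Fintype.card (HighVar n r) = n - r := by
  rw [Fintype.card_subtype_compl, Fintype.card_fin, Fintype.card_subtype]
  simp [Fin.card_filter_val_lt, hr]

/-- The low standard monomials generate `A` as a module over the polynomial ring in the high
variables, which embeds in `A`; so the extension is integral and the dimensions agree. -/
theorem ringKrullDim_eq_of_surjective {A : Type*} [CommRing A] {π : MvPolynomial (Fin n) k →+* A}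
    (hπ : Function.Surjective π) {r : ℕ} (hr : r ≤ n)
    (hpow : ∀ i : Fin n, (i : ℕ) < r → ∃ N, Finsupp.single i N ∈ leadExps (RingHom.ker π))
    (hinj : ∀ g : MvPolynomial (HighVar n r) k, highIncl k n r g ∈ RingHom.ker π → g = 0) :
    ringKrullDim A = ((n - r : ℕ) : WithBot ℕ∞) := by
  set I := RingHom.ker π
  let φ : MvPolynomial (HighVar n r) k →+* A :=
    π.comp (highIncl k n r : _ →+* MvPolynomial (Fin n) k)
  let : Algebra (MvPolynomial (HighVar n r) k) A := φ.toAlgebra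
  have hφ : ∀ g, algebraMap (MvPolynomial (HighVar n r) k) A g = π (highIncl k n r g) :=
    fun g => rfl
  have hfin : Module.Finite (MvPolynomial (HighVar n r) k) A := by
    refine ⟨Submodule.fg_def.2 ⟨(fun v => π (monomial v 1)) '' lowStandard r (leadExps I),
      (lowStandard_finite (isUpperSet_leadExps I) hpow).image _, ?_⟩⟩
    refine eq_top_iff.2 fun x _ => ?_
    obtain ⟨f, rfl⟩ := hπ x
    -- Removing only the monomials whose low part is a leading exponent keeps the high variables
    -- free to serve as coefficients.
    obtain ⟨g, hfg, hg, -⟩ := exists_reduction (I := I) (D := {w | cut r w ∈ leadExps I})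
      (fun w hw => isUpperSet_leadExps I (cut_le r w) hw) f
    rw [RingHom.mem_ker, map_sub, sub_eq_zero] at hfg
    rw [hfg, g.as_sum, map_sum]
    refine Submodule.sum_mem _ fun w hw => ?_
    rw [monomial_eq_highIncl_mul r w, map_mul, ← hφ, ← Algebra.smul_def]
    exact Submodule.smul_mem _ _ (Submodule.subset_span ⟨_, ⟨cut_cut r w, hg w hw⟩, rfl⟩)
  have hintegral : Algebra.IsIntegral (MvPolynomial (HighVar n r) k) A := inferInstance
  rw [ringKrullDim_eq_of_isIntegral_of_injective (R := MvPolynomial (HighVar n r) k),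
    MvPolynomial.ringKrullDim_of_isNoetherianRing, ringKrullDim_eq_zero_of_field, zero_add,
    Nat.card_eq_fintype_card, card_highVar hr]
  rw [injective_iff_map_eq_zero]
  exact fun g hg => hinj g hg

theorem ringKrullDim_quotient_eq {I : Ideal (MvPolynomial (Fin n) k)} {r : ℕ} (hr : r ≤ n)
    (hpow : ∀ i : Fin n, (i : ℕ) < r → ∃ N, Finsupp.single i N ∈ leadExps I)
    (hinj : ∀ g : MvPolynomial (HighVar n r) k, highIncl k n r g ∈ I → g = 0) :
    ringKrullDim (MvPolynomial (Fin n) k ⧸ I) = ((n - r : ℕ) : WithBot ℕ∞) := by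
  rw [← Ideal.mk_ker (I := I)] at hpow hinj
  exact ringKrullDim_eq_of_surjective Ideal.Quotient.mk_surjective hr hpow hinj

theorem hilbertFunction_span_monomial {E : Set (Fin n →₀ ℕ)} (hE : IsUpperSet E) (m : ℕ) :
    hilbertFunction (Ideal.span ((fun w => monomial w (1 : k)) '' E)) m =
      Nat.card {w : Fin n →₀ ℕ // w.degree = m ∧ w ∉ E} := by
  classical
  set I := Ideal.span ((fun w => monomial w (1 : k)) '' E) with hI
  let b : {w : Fin n →₀ ℕ // w.degree = m ∧ w ∉ E} → MvPolynomial (Fin n) k ⧸ I :=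
    fun w => Ideal.Quotient.mkₐ k I (monomial w.1 1)
  have hfin : Finite {w : Fin n →₀ ℕ // w.degree = m ∧ w ∉ E} := by
    have := Finsupp.finite_of_degree_le (σ := Fin n) m
    exact (this.subset (t := {w | w.degree = m ∧ w ∉ E}) fun w hw => hw.1.le).to_subtype
  have hspan : (homogeneousSubmodule (Fin n) k m).map (Ideal.Quotient.mkₐ k I).toLinearMap =
      Submodule.span k (Set.range b) := by
    refine le_antisymm ?_ (Submodule.span_le.2 ?_)
    · rintro _ ⟨f, hf, rfl⟩
      rw [f.as_sum, map_sum]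
      refine Submodule.sum_mem _ fun w hw => ?_
      by_cases hwE : w ∈ E
      · have : (Ideal.Quotient.mkₐ k I).toLinearMap (monomial w (coeff w f)) = 0 := by
          refine Ideal.Quotient.eq_zero_iff_mem.2 ((mem_span_monomial_iff hE).2 fun v hv => ?_)
          rw [Finset.mem_singleton.1 (support_monomial_subset hv)]
          exact hwE
        rw [this]
        exact Submodule.zero_mem _
      · have : monomial w (coeff w f) = coeff w f • monomial w (1 : k) := by
          rw [smul_monomial, smul_eq_mul, mul_one]
        rw [this, map_smul]
        refine Submodule.smul_mem _ _ (Submodule.subset_span ⟨⟨w, ?_, hwE⟩, rfl⟩)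
        have := (mem_homogeneousSubmodule m f).1 hf (mem_support_iff.1 hw)
        rwa [Finsupp.degree_eq_weight_one]
    · rintro _ ⟨w, rfl⟩
      refine ⟨monomial w.1 1, ?_, rfl⟩
      exact isHomogeneous_monomial _ w.2.1
  have hli : LinearIndependent k b := by
    rw [linearIndependent_iff]
    intro l hl
    rw [Finsupp.linearCombination_apply] at hl
    have h1 : (l.sum fun w a => monomial w.1 a) ∈ I := by
      rw [← Ideal.Quotient.eq_zero_iff_mem, ← hl, Finsupp.sum, map_sum]
      refine Finset.sum_congr rfl fun w _ => ?_
      change _ = l w • Ideal.Quotient.mkₐ k I _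
      rw [← map_smul, smul_monomial, smul_eq_mul, mul_one]
      rfl
    rw [hI, mem_span_monomial_iff hE] at h1
    ext w
    by_contra h0
    refine w.2.2 (h1 w.1 ?_)
    rw [mem_support_iff, Finsupp.sum, coeff_sum]
    simp only [coeff_monomial, Subtype.val_inj]
    simpa using h0
  have := Fintype.ofFinite {w : Fin n →₀ ℕ // w.degree = m ∧ w ∉ E}
  rw [hilbertFunction, hspan, finrank_span_eq_card hli, Nat.card_eq_fintype_card]

theorem card_degree_eq_series (τ : Type*) [Fintype τ] [DecidableEq τ] :
    (PowerSeries.mk fun m => (Nat.card {t : τ →₀ ℕ // t.degree = m} : ℤ)) *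
      (1 - PowerSeries.X) ^ Fintype.card τ = 1 := by
  have h : (PowerSeries.mk fun m => (Nat.card {t : τ →₀ ℕ // t.degree = m} : ℤ)) =
      (PowerSeries.invOneSubPow ℤ (Fintype.card τ)).val := by
    ext m
    have h1 : Nat.card {t : τ →₀ ℕ // t.degree = m} = (Fintype.card τ).multichoose m := by
      rw [← Sym.card_sym_eq_multichoose, ← Nat.card_eq_fintype_card]
      exact (Nat.card_congr (Sym.equivNatSum τ m)).symm
    rw [PowerSeries.coeff_mk, h1]
    cases Fintype.card τ with
    | zero =>
      rw [PowerSeries.invOneSubPow_zero]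
      cases m <;> simp [PowerSeries.coeff_one]
    | succ d =>
      rw [PowerSeries.invOneSubPow_val_succ_eq_mk_add_choose, PowerSeries.coeff_mk,
        Nat.multichoose_eq, show d + 1 + m - 1 = d + m by omega, Nat.choose_symm_add]
  rw [h, ← PowerSeries.invOneSubPow_inv_eq_one_sub_pow]
  exact (PowerSeries.invOneSubPow ℤ (Fintype.card τ)).val_inv

theorem degree_eq_cut_add_high (r : ℕ) (w : Fin n →₀ ℕ) :
    w.degree = (cut r w).degree + (high r w).degree := by
  rw [Finsupp.degree_eq_sum, Finsupp.degree_eq_sum, Finsupp.degree_eq_sum,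
    ← Fintype.sum_subtype_add_sum_subtype (fun i : Fin n => (i : ℕ) < r) w,
    ← Fintype.sum_subtype_add_sum_subtype (fun i : Fin n => (i : ℕ) < r) (cut r w)]
  have h1 : ∑ i : LowVar n r, cut r w i.1 = ∑ i : LowVar n r, w i.1 :=
    Finset.sum_congr rfl fun i _ => cut_apply_of_lt i.2 w
  have h2 : ∑ i : HighVar n r, cut r w i.1 = 0 :=
    Finset.sum_eq_zero fun i _ => cut_apply_of_not_lt i.2 w
  rw [h1, h2, add_zero]
  rfl

theorem card_standard_eq (r : ℕ) (B : Finset (Fin n →₀ ℕ)) (hB : ∀ v ∈ B, cut r v = v) (m : ℕ) :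
    Nat.card {w : Fin n →₀ ℕ // w.degree = m ∧ cut r w ∈ B} =
      ∑ v ∈ B, Nat.card {t : HighVar n r →₀ ℕ // v.degree + t.degree = m} := by
  have hfin : ∀ v : B, Finite {t : HighVar n r →₀ ℕ // v.1.degree + t.degree = m} := fun v =>
    ((Finsupp.finite_of_degree_le (σ := HighVar n r) m).subset
      (t := {t | v.1.degree + t.degree = m}) fun t ht => by
        rw [Set.mem_ofPred_eq] at ht ⊢; omega).to_subtype
  rw [← Finset.sum_coe_sort B, ← Nat.card_sigma]
  let φ : {w : Fin n →₀ ℕ // w.degree = m ∧ cut r w ∈ B} →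
      Σ v : B, {t : HighVar n r →₀ ℕ // v.1.degree + t.degree = m} :=
    fun w => ⟨⟨cut r w.1, w.2.2⟩, ⟨high r w.1, by rw [← degree_eq_cut_add_high, w.2.1]⟩⟩
  refine Nat.card_congr (Equiv.ofBijective φ ⟨fun w w' h => ?_, fun ⟨v, t⟩ => ?_⟩)
  · have h1 : cut r w.1 = cut r w'.1 := congrArg (fun x => x.1.1) h
    have h2 : high r w.1 = high r w'.1 := congrArg (fun x => x.2.1) h
    exact Subtype.ext (eq_of_low_eq_of_high_eq (cut_eq_iff_low_eq.1 h1) h2)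
  · obtain ⟨w, hw1, hw2⟩ := exists_low_high (low r v.1) t.1
    have hcut : cut r w = v.1 := (cut_eq_iff_low_eq.2 hw1).trans (hB _ v.2)
    refine ⟨⟨w, ?_, by rw [hcut]; exact v.2⟩, ?_⟩
    · rw [degree_eq_cut_add_high r, hcut, hw2, t.2]
    · obtain ⟨⟨v, hv⟩, ⟨t, ht⟩⟩ := v, t
      simp only at hcut hw2
      subst hcut hw2
      rfl

/-- The standard monomials are the products of a monomial from `B` with an arbitrary monomial in the
`n - r` high variables. So the Hilbert series is the sum of `t^(deg v)`, `v ∈ B`, divided by `(1 -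
t)^(n - r)`. -/
theorem deg_span_monomial {E : Set (Fin n →₀ ℕ)} (hE : IsUpperSet E) {r : ℕ} (hr : r ≤ n)
    {B : Finset (Fin n →₀ ℕ)} (hB : ∀ v ∈ B, cut r v = v)
    (hEB : ∀ w, w ∉ E ↔ cut r w ∈ B) :
    deg (Ideal.span ((fun w => monomial w (1 : k)) '' E)) = B.card := by
  set I := Ideal.span ((fun w => monomial w (1 : k)) '' E) with hI
  have hdim : B.Nonempty → dimQuot I = n - r := by
    intro hne
    have : ringKrullDim (MvPolynomial (Fin n) k ⧸ I) = ((n - r : ℕ) : WithBot ℕ∞) := by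
      refine ringKrullDim_quotient_eq hr (fun i hi => ?_) fun g hg => ?_
      · obtain ⟨N, hN⟩ : ∃ N, Finsupp.single i N ∈ E := by
          by_contra! h
          have hsub : Set.range (fun N => Finsupp.single i N) ⊆ (B : Set (Fin n →₀ ℕ)) := by
            rintro _ ⟨N, rfl⟩
            have := (hEB _).1 (h N)
            rwa [cut_single_of_lt hi] at this
          exact Set.infinite_range_of_injective (Finsupp.single_injective i)
            (B.finite_toSet.subset hsub)
        classical
        refine ⟨N, monomial (Finsupp.single i N) 1,
          (monomial_mem_span_monomial_iff hE).2 hN, by simp, ?_⟩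
        rw [MonomialOrder.degree_monomial, if_neg one_ne_zero]
      · rw [hI, mem_span_monomial_iff hE] at hg
        by_contra h0
        obtain ⟨t, ht⟩ := ne_zero_iff.1 h0
        obtain ⟨w, hw1, hw2⟩ := exists_low_high (n := n) (r := r) 0 t
        refine ((hEB w).2 ?_) (hg w ?_)
        · have : cut r w = 0 := by
            rw [← cut_zero r]
            exact cut_eq_iff_low_eq.2 (by rw [hw1]; rfl)
          rw [this]
          obtain ⟨v, hv⟩ := hne
          have hv' := (hEB v).2 (by rwa [hB v hv])
          have := (hEB 0).1 fun h => hv' (hE zero_le h)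
          rwa [cut_zero] at this
        · rw [mem_support_iff, ← coeff_split (r := r), split_highIncl, hw1, hw2]
          simpa using ht
    rw [dimQuot, this]
    rfl
  have hseries : ((∑ v ∈ B, Polynomial.X ^ v.degree : Polynomial ℤ) : PowerSeries ℤ) =
      hilbertSeries I * (1 - PowerSeries.X) ^ dimQuot I := by
    have h1 : hilbertSeries I = (∑ v ∈ B, PowerSeries.X ^ v.degree) *
        PowerSeries.mk fun m => (Nat.card {t : HighVar n r →₀ ℕ // t.degree = m} : ℤ) := by
      ext m
      rw [hilbertSeries, PowerSeries.coeff_mk, hilbertFunction_span_monomial hE]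
      simp only [hEB]
      rw [card_standard_eq r B hB, Finset.sum_mul, map_sum, Nat.cast_sum]
      refine Finset.sum_congr rfl fun v _ => ?_
      rw [PowerSeries.coeff_X_pow_mul']
      split_ifs with hvm
      · rw [PowerSeries.coeff_mk]
        exact congrArg _ (Nat.card_congr (Equiv.subtypeEquivRight fun t => by omega))
      · rw [Nat.cast_eq_zero, Nat.card_eq_zero]
        exact Or.inl ⟨fun t => hvm (by have := t.2; omega)⟩
    -- For empty `B` the quotient is zero and `dimQuot` takes its default value, but the series
    -- vanishes anyway.
    rcases B.eq_empty_or_nonempty with rfl | hne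
    · simp [h1]
    rw [h1, hdim hne, ← card_highVar hr, mul_assoc, card_degree_eq_series, mul_one]
    rw [← Polynomial.coeToPowerSeries.ringHom_apply, map_sum]
    simp
  have hex : ∃ q : Polynomial ℤ,
      (q : PowerSeries ℤ) = hilbertSeries I * (1 - PowerSeries.X) ^ dimQuot I := ⟨_, hseries⟩
  have hq : hilbertNumerator I = ∑ v ∈ B, Polynomial.X ^ v.degree := by
    rw [hilbertNumerator, dif_pos hex]
    exact Polynomial.coe_injective ℤ (hex.choose_spec.trans hseries.symm)
  rw [deg, hq]
  simp [Polynomial.eval_finsetSum]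

end Dimension

/-! ### The degrees of `Φ_r(J)` and `Π_r(J)` -/

section PhiPi

variable {k : Type*} [Field k] {n : ℕ}

theorem minGens_span_monomial {E : Set (Fin n →₀ ℕ)} (hE : IsUpperSet E) :
    minGens (Ideal.span ((fun w => monomial w (1 : k)) '' E)) = {u | Minimal (· ∈ E) u} := by
  simp only [minGens, monomial_mem_span_monomial_iff hE]

theorem exists_minimal_le {E : Set (Fin n →₀ ℕ)} {w : Fin n →₀ ℕ} (hw : w ∈ E) :
    ∃ u, Minimal (· ∈ E) u ∧ u ≤ w := by
  obtain ⟨u, hu, hmin⟩ := exists_minimal_le_of_wellFoundedLT (· ∈ E) w hw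
  exact ⟨u, hmin, hu⟩

/-- The exponents of the monomials of `Φ_r(J)`, where `E` are those of the monomials of `J`. -/
def phiExps (r : ℕ) (E : Set (Fin n →₀ ℕ)) : Set (Fin n →₀ ℕ) := {w | ∃ t ∈ E, cut r t ≤ w}

theorem isUpperSet_phiExps (r : ℕ) (E : Set (Fin n →₀ ℕ)) : IsUpperSet (phiExps r E) :=
  fun _ _ hle ⟨t, ht, h⟩ => ⟨t, ht, h.trans hle⟩

theorem subset_phiExps (r : ℕ) (E : Set (Fin n →₀ ℕ)) : E ⊆ phiExps r E :=
  fun w hw => ⟨w, hw, cut_le r w⟩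

theorem cut_mono (r : ℕ) {v w : Fin n →₀ ℕ} (h : v ≤ w) : cut r v ≤ cut r w := by
  intro i
  simp only [Finsupp.filter_apply]
  split_ifs
  · exact h i
  · exact le_rfl

/-- `Φ_r(J)` is generated by monomials in the first `r` variables, so membership depends on the low
part alone. -/
theorem cut_mem_phiExps_iff {r : ℕ} {E : Set (Fin n →₀ ℕ)} {w : Fin n →₀ ℕ} :
    cut r w ∈ phiExps r E ↔ w ∈ phiExps r E := by
  refine ⟨fun h => isUpperSet_phiExps r E (cut_le r w) h, fun ⟨t, ht, h⟩ => ⟨t, ht, ?_⟩⟩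
  rw [← cut_cut]
  exact cut_mono r h

/-- Cutting is monotone, so cutting every monomial of `J`, not only the minimal generators, adds
nothing but multiples. -/
theorem Phi_span_monomial {E : Set (Fin n →₀ ℕ)} (hE : IsUpperSet E) (r : ℕ) :
    Phi r (Ideal.span ((fun w => monomial w (1 : k)) '' E)) =
      Ideal.span ((fun w => monomial w (1 : k)) '' phiExps r E) := by
  rw [Phi, minGens_span_monomial hE]
  refine le_antisymm (Ideal.span_mono ?_) (Ideal.span_le.2 ?_)
  · rintro _ ⟨u, hu, rfl⟩
    exact ⟨_, ⟨u, hu.prop, le_rfl⟩, rfl⟩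
  · rintro _ ⟨w, ⟨t, ht, h⟩, rfl⟩
    obtain ⟨u, hu, hut⟩ := exists_minimal_le ht
    obtain ⟨v, rfl⟩ := exists_add_of_le ((cut_mono r hut).trans h)
    have : monomial (cut r u + v) (1 : k) = monomial v 1 * monomial (cut r u) 1 := by
      rw [monomial_mul, mul_one, add_comm]
    simp only [this]
    exact Ideal.mul_mem_left _ _ (Ideal.subset_span ⟨u, hu, rfl⟩)

theorem deg_Phi {E : Set (Fin n →₀ ℕ)} (hE : IsUpperSet E) {r : ℕ} (hr : r ≤ n)
    (hfin : (lowStandard r (phiExps r E)).Finite) :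
    deg (Phi r (Ideal.span ((fun w => monomial w (1 : k)) '' E))) =
      (lowStandard r (phiExps r E)).ncard := by
  rw [Phi_span_monomial hE, deg_span_monomial (isUpperSet_phiExps r E) hr (B := hfin.toFinset),
    Set.ncard_eq_toFinset_card _ hfin]
  · intro v hv
    exact (hfin.mem_toFinset.1 hv).1
  · intro w
    rw [hfin.mem_toFinset, ← cut_mem_phiExps_iff]
    exact ⟨fun h => ⟨cut_cut r w, h⟩, fun h => h.2⟩

theorem piHom_rename {r : ℕ} (hr : r ≤ n) (g : MvPolynomial (Fin r) k) :
    piHom k n r (rename (Fin.castLE hr) g) = g := by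
  have : (piHom k n r).comp (rename (Fin.castLE hr)) = AlgHom.id k _ := by
    ext i : 1
    simp [piHom]
  exact DFunLike.congr_fun this g

theorem piHom_monomial_of_cut_ne {r : ℕ} {w : Fin n →₀ ℕ} (hw : cut r w ≠ w) :
    piHom k n r (monomial w 1) = 0 := by
  obtain ⟨i, hi⟩ := DFunLike.ne_iff.1 hw
  have hir : ¬ (i : ℕ) < r := fun h => hi (cut_apply_of_lt h w)
  rw [cut_apply_of_not_lt hir] at hi
  rw [piHom, aeval_monomial, Finsupp.prod, Finset.prod_eq_zero (i := i), mul_zero]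
  · simpa using hi.symm
  · rw [dif_neg hir, zero_pow hi.symm]

theorem exists_mapDomain_castLE_eq {r : ℕ} (hr : r ≤ n) {w : Fin n →₀ ℕ} (hw : cut r w = w) :
    ∃ v : Fin r →₀ ℕ, v.mapDomain (Fin.castLE hr) = w := by
  refine ⟨w.comapDomain (Fin.castLE hr) (Fin.castLE_injective hr).injOn,
    Finsupp.mapDomain_comapDomain _ (Fin.castLE_injective hr) _ ?_⟩
  intro i hi
  have hir : (i : ℕ) < r := by
    by_contra h
    rw [← hw] at hi
    simp [h] at hi
  exact ⟨⟨i, hir⟩, rfl⟩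

theorem cut_mapDomain_castLE {r : ℕ} (hr : r ≤ n) (v : Fin r →₀ ℕ) :
    cut r (v.mapDomain (Fin.castLE hr)) = v.mapDomain (Fin.castLE hr) := by
  ext i
  by_cases hi : (i : ℕ) < r
  · rw [cut_apply_of_lt hi]
  · rw [cut_apply_of_not_lt hi, Finsupp.mapDomain_of_notMem_range]
    rintro ⟨j, rfl⟩
    exact hi j.2

theorem map_piHom_span_monomial {r : ℕ} (hr : r ≤ n) (E : Set (Fin n →₀ ℕ)) :
    (Ideal.span ((fun w => monomial w (1 : k)) '' E)).map (piHom k n r) =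
      Ideal.span ((fun w => monomial w (1 : k)) ''
        {v : Fin r →₀ ℕ | v.mapDomain (Fin.castLE hr) ∈ E}) := by
  have hmon : ∀ v : Fin r →₀ ℕ,
      piHom k n r (monomial (v.mapDomain (Fin.castLE hr)) 1) = monomial v 1 := fun v => by
    rw [← rename_monomial, piHom_rename]
  rw [Ideal.map_span]
  refine le_antisymm (Ideal.span_le.2 ?_) (Ideal.span_mono ?_)
  · rintro _ ⟨_, ⟨w, hw, rfl⟩, rfl⟩
    by_cases hcut : cut r w = w
    · obtain ⟨v, rfl⟩ := exists_mapDomain_castLE_eq hr hcut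
      exact Ideal.subset_span ⟨v, hw, (hmon v).symm⟩
    · change piHom k n r (monomial w 1) ∈ _
      rw [piHom_monomial_of_cut_ne hcut]
      exact Ideal.zero_mem _
  · rintro _ ⟨v, hv, rfl⟩
    exact ⟨_, ⟨_, hv, rfl⟩, hmon v⟩

theorem deg_map_piHom {E : Set (Fin n →₀ ℕ)} (hE : IsUpperSet E) {r : ℕ} (hr : r ≤ n)
    (hfin : (lowStandard r E).Finite) :
    deg ((Ideal.span ((fun w => monomial w (1 : k)) '' E)).map (piHom k n r)) =
      (lowStandard r E).ncard := by
  have hinj := Finsupp.mapDomain_injective (M := ℕ) (Fin.castLE_injective hr)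
  have himg : lowStandard r E =
      Finsupp.mapDomain (Fin.castLE hr) '' {v : Fin r →₀ ℕ | v.mapDomain (Fin.castLE hr) ∉ E} := by
    ext w
    constructor
    · rintro ⟨hw, hwE⟩
      obtain ⟨v, rfl⟩ := exists_mapDomain_castLE_eq hr hw
      exact ⟨v, hwE, rfl⟩
    · rintro ⟨v, hv, rfl⟩
      exact ⟨cut_mapDomain_castLE hr v, hv⟩
  rw [himg] at hfin ⊢
  have hfin' := hfin.of_finite_image hinj.injOn
  have hcut : ∀ v : Fin r →₀ ℕ, cut r v = v := fun v =>
    Finsupp.filter_eq_self_iff _ _ |>.2 fun i _ => i.2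
  rw [Set.ncard_image_of_injective _ hinj, map_piHom_span_monomial hr,
    -- In `S(r)` all `r` variables are low and no high ones remain, so the degree is the number of
    -- standard monomials.
    deg_span_monomial ?_ le_rfl (B := hfin'.toFinset) (fun v _ => hcut v),
    Set.ncard_eq_toFinset_card _ hfin']
  · intro v
    rw [hcut, hfin'.mem_toFinset]
    rfl
  · intro v w hle hv
    exact hE (Finsupp.mapDomain_mono hle) hv

end PhiPi

/-! ### Linear changes of coordinates -/

section CoordChange

variable {k : Type*} [Field k] {n : ℕ}

theorem coordChange_X (α : GL (Fin n) k) (j : Fin n) :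
    coordChange α (X j) = ∑ i, C ((α : Matrix (Fin n) (Fin n) k) i j) * X i := by
  simp [coordChange]

theorem coordChange_one : coordChange (1 : GL (Fin n) k) = AlgHom.id k _ := by
  ext j : 1
  rw [coordChange_X, Finset.sum_eq_single j]
  · simp
  · intro i _ hij
    simp [Matrix.one_apply_ne hij]
  · simp

theorem coordChange_mul (α β : GL (Fin n) k) :
    coordChange (α * β) = (coordChange α).comp (coordChange β) := by
  ext j : 1
  simp only [AlgHom.comp_apply, coordChange_X, map_sum, map_mul, algHom_C, Units.val_mul,
    Matrix.mul_apply, Finset.mul_sum, Finset.sum_mul, algebraMap_eq]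
  rw [Finset.sum_comm]
  refine Finset.sum_congr rfl fun i _ => Finset.sum_congr rfl fun l _ => ?_
  ring

/-- The linear change of coordinates as an automorphism. -/
def coordEquiv (α : GL (Fin n) k) : MvPolynomial (Fin n) k ≃ₐ[k] MvPolynomial (Fin n) k :=
  AlgEquiv.ofAlgHom (coordChange α) (coordChange α⁻¹)
    (by rw [← coordChange_mul, mul_inv_cancel, coordChange_one])
    (by rw [← coordChange_mul, inv_mul_cancel, coordChange_one])

theorem coordChange_homogeneousComponent (α : GL (Fin n) k) (m : ℕ) (f : MvPolynomial (Fin n) k) :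
    coordChange α (homogeneousComponent m f) = homogeneousComponent m (coordChange α f) := by
  have hhom : ∀ l, (coordChange α (homogeneousComponent l f)).IsHomogeneous l := by
    intro l
    have := (homogeneousComponent_isHomogeneous l f).aeval
      (g := fun j => ∑ i, C ((α : Matrix (Fin n) (Fin n) k) i j) * X i) (n := 1)
      (fun j => IsHomogeneous.sum _ _ _ fun i _ => isHomogeneous_C_mul_X _ _)
    rwa [one_mul] at this
  conv_rhs => rw [← sum_homogeneousComponent f, map_sum, map_sum]
  rw [Finset.sum_congr rfl fun l _ => homogeneousComponent_of_mem (hhom l)]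
  rw [Finset.sum_ite_eq]
  split_ifs with h
  · rfl
  · rw [homogeneousComponent_eq_zero, map_zero]
    simpa using h

theorem coordChange_mem_idealOfVars_iff (α : GL (Fin n) k) (f : MvPolynomial (Fin n) k) :
    coordChange α f ∈ idealOfVars (Fin n) k ↔ f ∈ idealOfVars (Fin n) k := by
  have h := coordChange_homogeneousComponent α 0 f
  rw [homogeneousComponent_zero, homogeneousComponent_zero, algHom_C, algebraMap_eq] at h
  rw [mem_idealOfVars_iff, mem_idealOfVars_iff, ← C_injective _ _ h]

/-- `Q` contains the homogeneous components of its elements. -/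
def ComponentClosed (Q : Ideal (MvPolynomial (Fin n) k)) : Prop :=
  ∀ f ∈ Q, ∀ m, homogeneousComponent m f ∈ Q

theorem componentClosed_of_isHomogeneousIdeal {P : Ideal (MvPolynomial (Fin n) k)}
    (h : IsHomogeneousIdeal P) : ComponentClosed P :=
  fun _ hf m => homogeneousComponent_mem_of_mem h hf m

theorem mem_map_coordChange_iff {P : Ideal (MvPolynomial (Fin n) k)} {α : GL (Fin n) k}
    {f : MvPolynomial (Fin n) k} : f ∈ P.map (coordChange α) ↔ ∃ g ∈ P, coordChange α g = f :=
  Ideal.mem_map_iff_of_surjective (coordChange α) (coordEquiv α).surjective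

theorem ComponentClosed.map_coordChange {P : Ideal (MvPolynomial (Fin n) k)}
    (h : ComponentClosed P) (α : GL (Fin n) k) : ComponentClosed (P.map (coordChange α)) := by
  intro f hf m
  obtain ⟨g, hg, rfl⟩ := mem_map_coordChange_iff.1 hf
  rw [← coordChange_homogeneousComponent]
  exact mem_map_coordChange_iff.2 ⟨_, h g hg m, rfl⟩

theorem map_coordChange_mul (P : Ideal (MvPolynomial (Fin n) k)) (α β : GL (Fin n) k) :
    P.map (coordChange (β * α)) = (P.map (coordChange α)).map (coordChange β) := by
  ext f
  have hmul : ∀ g, coordChange (β * α) g = coordChange β (coordChange α g) := fun g => by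
    rw [coordChange_mul, AlgHom.comp_apply]
  simp only [mem_map_coordChange_iff, hmul]
  constructor
  · rintro ⟨g, hg, rfl⟩
    exact ⟨_, ⟨g, hg, rfl⟩, rfl⟩
  · rintro ⟨_, ⟨g, hg, rfl⟩, rfl⟩
    exact ⟨g, hg, rfl⟩

/-- Turns the coefficient of a pure power after a change of coordinates into a value of the original
form, which is nonzero for a generic choice. -/
theorem coeff_single_eq_eval_of_isHomogeneous {f : MvPolynomial (Fin n) k} {e : ℕ}
    (hf : f.IsHomogeneous e) (i : Fin n) :
    coeff (Finsupp.single i e) f = eval (Pi.single i 1) f := by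
  classical
  rw [eval_eq', Finset.sum_eq_single (Finsupp.single i e)]
  · rw [Finset.prod_eq_one, mul_one]
    intro j _
    by_cases h : j = i
    · subst h; simp
    · simp [Ne.symm h]
  · intro w hw hne
    have hdeg : w.degree = e := by
      by_contra h
      exact (mem_support_iff.1 hw) (hf.coeff_eq_zero h)
    obtain ⟨j, hji, hj⟩ : ∃ j, j ≠ i ∧ w j ≠ 0 := by
      by_contra! h
      refine hne ?_
      have : w = Finsupp.single i (w i) := by
        ext j
        by_cases hji : j = i
        · subst hji; simp
        · rw [h j hji, Finsupp.single_apply, if_neg (Ne.symm hji)]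
      rw [this, Finsupp.degree_single] at hdeg
      rw [this, hdeg]
    rw [Finset.prod_eq_zero (Finset.mem_univ j), mul_zero]
    rw [Pi.single_eq_of_ne hji, zero_pow hj]
  · intro h
    rw [notMem_support_iff.1 h, zero_mul]

end CoordChange

/-! ### Generic changes of the last variables -/

section Generic

variable {k : Type*} [Field k] {n : ℕ}

/-- The matrix of `x_j ↦ x_j + b_j x_r` for `j > r`, `x_r ↦ b_r x_r`. -/
def shearMatrix {A : Type*} [CommRing A] (r : Fin n) (b : Fin n → A) : Matrix (Fin n) (Fin n) A :=
  Matrix.updateRow 1 r fun j => if j < r then 0 else b j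

theorem det_shearMatrix {A : Type*} [CommRing A] (r : Fin n) (b : Fin n → A) :
    (shearMatrix r b).det = b r := by
  rw [Matrix.det_of_isUpperTriangular, Finset.prod_eq_single r]
  · simp [shearMatrix]
  · intro i _ hi
    simp [shearMatrix, Matrix.updateRow_ne hi]
  · simp
  · intro i j hij
    by_cases hi : i = r
    · subst hi
      simpa [shearMatrix] using fun h => absurd hij (not_lt.2 h)
    · rw [shearMatrix, Matrix.updateRow_ne hi]
      exact Matrix.one_apply_ne (ne_of_gt hij)

theorem shearMatrix_single (r : Fin n) : shearMatrix r (Pi.single r (1 : k)) = 1 := by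
  ext i j
  by_cases hi : i = r
  · subst hi
    by_cases hj : j = i
    · subst hj
      simp [shearMatrix]
    · simp [shearMatrix, hj, Matrix.one_apply_ne (Ne.symm hj)]
  · rw [shearMatrix, Matrix.updateRow_ne hi]

theorem toRevLex_le_single {r : Fin n} {e : ℕ} {w : Fin n →₀ ℕ} (hw : ∀ i < r, w i = 0)
    (hdeg : w.degree ≤ e) : toRevLex w ≤ toRevLex (Finsupp.single r e) := by
  rcases eq_or_ne w (Finsupp.single r e) with rfl | hne
  · exact le_rfl
  refine le_of_lt (RevLex.lt_iff.2 ?_)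
  rw [Finsupp.degree_single]
  rcases hdeg.lt_or_eq with h | h
  · exact Or.inl h
  refine Or.inr ⟨h, ?_⟩
  classical
  have hne' : (Finset.univ.filter fun i => r < i ∧ w i ≠ 0).Nonempty := by
    by_contra hem
    rw [Finset.not_nonempty_iff_eq_empty, Finset.filter_eq_empty_iff] at hem
    have hw' : w = Finsupp.single r (w r) := by
      ext j
      rcases lt_trichotomy j r with hj | rfl | hj
      · rw [hw j hj, Finsupp.single_apply, if_neg hj.ne']
      · simp
      · have : w j = 0 := by
          by_contra h0
          exact hem (Finset.mem_univ j) ⟨hj, h0⟩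
        rw [this, Finsupp.single_apply, if_neg hj.ne]
    refine hne ?_
    rw [hw', Finsupp.degree_single] at h
    rw [hw', h]
  set i := Finset.max' _ hne' with hi
  have hmem := Finset.max'_mem _ hne'
  rw [← hi, Finset.mem_filter] at hmem
  refine ⟨i, fun j hj => ?_, ?_⟩
  · have h0 : w j = 0 := by
      by_contra h0
      exact absurd (Finset.le_max' _ j (by simp [hmem.2.1.trans hj, h0])) (not_le.2 hj)
    rw [h0, Finsupp.single_apply, if_neg (hmem.2.1.trans hj).ne]
  · rw [Finsupp.single_apply, if_neg hmem.2.1.ne]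
    exact Nat.pos_of_ne_zero hmem.2.2

theorem apply_eq_zero_of_mem_support_highIncl {r : ℕ} {g : MvPolynomial (HighVar n r) k}
    {w : Fin n →₀ ℕ} (hw : w ∈ (highIncl k n r g).support) (i : Fin n) (hi : (i : ℕ) < r) :
    w i = 0 := by
  classical
  by_contra h0
  rw [mem_support_iff, ← coeff_split (r := r), split_highIncl, coeff_C, if_neg, coeff_zero] at hw
  · exact hw rfl
  · intro h
    exact h0 (DFunLike.congr_fun h ⟨i, hi⟩).symm

theorem homogeneousComponent_totalDegree_ne_zero {σ : Type*} {g : MvPolynomial σ k} (hg : g ≠ 0) :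
    homogeneousComponent g.totalDegree g ≠ 0 := by
  obtain ⟨w, hw, h⟩ := Finset.exists_mem_eq_sup g.support (support_nonempty.2 hg)
    fun s => s.sum fun _ e => e
  intro h0
  have h1 := congrArg (coeff w) h0
  rw [coeff_homogeneousComponent, if_pos, coeff_zero] at h1
  · exact (mem_support_iff.1 hw) h1
  · exact h.symm

theorem eval_coordChange (α : GL (Fin n) k) (b : Fin n → k) (f : MvPolynomial (Fin n) k) :
    eval b (coordChange α f) =
      eval (fun j => ∑ i, (α : Matrix (Fin n) (Fin n) k) i j * b i) f := by
  have : (aeval b).comp (coordChange α) =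
      aeval (R := k) fun j => ∑ i, (α : Matrix (Fin n) (Fin n) k) i j * b i := by
    ext j : 1
    simp [coordChange_X]
  simpa [coe_aeval_eq_eval] using DFunLike.congr_fun this f

/-- After the shear with parameters `b`, the coefficient of `x_{r+1}^e`, `e` the total degree of
`g`, is the value at `b` of the top form of `g`. When it is nonzero, `x_{r+1}^e` leads, being the
largest monomial of degree at most `e` in the high variables. The shear fixes the low variables, so
it acts through `θ` on the coefficients of `split`; this is what preserves relations. -/
theorem exists_generic_shear [Infinite k] {U : Set (GL (Fin n) k)} (hU : IsZariskiOpen U)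
    {α : GL (Fin n) k} (hα : α ∈ U) {r : ℕ} (hr : r < n) {g : MvPolynomial (HighVar n r) k}
    (hg : g ≠ 0) :
    ∃ β : GL (Fin n) k, β * α ∈ U ∧
      ∃ θ : MvPolynomial (HighVar n r) k →ₐ[k] MvPolynomial (HighVar n r) k,
        (∀ f, split k n r (coordChange β f) = map (θ : _ →+* _) (split k n r f)) ∧ θ g ≠ 0 ∧
          ∃ e, (degRevLex n).degree (highIncl k n r (θ g)) = Finsupp.single ⟨r, hr⟩ e := by
  classical
  obtain ⟨T, rfl⟩ := hU
  obtain ⟨F, hFT, hF⟩ := hα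
  set s : Fin n := ⟨r, hr⟩ with hs
  let A : Matrix (Fin n) (Fin n) k := α
  -- `F'` is `F` pulled back along `b ↦ shearMatrix s b * α`.
  let F' : MvPolynomial (Fin n) k :=
    bind₁ (fun p => ∑ l, shearMatrix s (X : Fin n → MvPolynomial (Fin n) k) p.1 l * C (A l p.2)) F
  have hF' : ∀ b : Fin n → k,
      eval b F' = eval (fun p => (shearMatrix s b * A) p.1 p.2) F := by
    intro b
    have hshear : ∀ i l, eval b (shearMatrix s (X : Fin n → MvPolynomial (Fin n) k) i l) =
        shearMatrix s b i l := by
      intro i l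
      by_cases hi : i = s
      · subst hi
        simp only [shearMatrix, Matrix.updateRow_self]
        split_ifs <;> simp
      · simp only [shearMatrix, Matrix.updateRow_ne hi, Matrix.one_apply]
        split_ifs <;> simp
    have haeval : ∀ (τ : Type) (c : τ → k) (f : MvPolynomial τ k), eval c f = aeval c f :=
      fun τ c f => by rw [← coe_aeval_eq_eval]; rfl
    rw [haeval, haeval, aeval_bind₁]
    simp only [← haeval, map_sum, map_mul, hshear, eval_C, Matrix.mul_apply]
  set e := g.totalDegree
  have htop : homogeneousComponent e g ≠ 0 := homogeneousComponent_totalDegree_ne_zero hg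
  let G : MvPolynomial (Fin n) k := highIncl k n r (homogeneousComponent e g)
  -- The factors keep `β * α` in `U`, make the leading exponent a pure power, and make the shear
  -- invertible. `F'` is nonzero because the unit vector at `s` gives the identity matrix, hence `F`
  -- at `α`.
  have hprod : F' * G * X s ≠ 0 := by
    refine mul_ne_zero (mul_ne_zero ?_ ?_) (X_ne_zero s)
    · intro h
      have := hF' (Pi.single s 1)
      rw [h, map_zero, shearMatrix_single, one_mul] at this
      exact hF this.symm
    · exact fun h => htop (rename_injective _ Subtype.val_injective (by simpa [G, highIncl] using h))
  obtain ⟨b, hb⟩ : ∃ b : Fin n → k, eval b (F' * G * X s) ≠ 0 := by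
    by_contra! h
    exact hprod (MvPolynomial.funext fun b => by rw [h b, map_zero])
  rw [map_mul, map_mul, eval_X] at hb
  have hbs : b s ≠ 0 := right_ne_zero_of_mul hb
  have hbF : eval b F' ≠ 0 := left_ne_zero_of_mul (left_ne_zero_of_mul hb)
  have hbG : eval b G ≠ 0 := right_ne_zero_of_mul (left_ne_zero_of_mul hb)
  let β : GL (Fin n) k := Matrix.GeneralLinearGroup.mkOfDetNeZero (shearMatrix s b)
    (by rwa [det_shearMatrix])
  have hβ : (β : Matrix (Fin n) (Fin n) k) = shearMatrix s b := rfl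
  let s' : HighVar n r := ⟨s, lt_irrefl _⟩
  let θ : MvPolynomial (HighVar n r) k →ₐ[k] MvPolynomial (HighVar n r) k :=
    aeval fun j => if j = s' then C (b s) * X s' else X j + C (b j) * X s'
  have hβX : ∀ j : Fin n, coordChange β (X j) = if j < s then X j else
      if j = s then C (b s) * X s else X j + C (b j) * X s := by
    intro j
    have hterm : ∀ i, C ((β : Matrix (Fin n) (Fin n) k) i j) * X i =
        (if i = s then C (if j < s then 0 else b j) * X s else 0) +
          (if i = j then (if j = s then 0 else X j) else 0) := by
      intro i
      rw [hβ]
      by_cases hi : i = s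
      · by_cases hj : s = j
        · simp [shearMatrix, hi, ← hj]
        · simp [shearMatrix, hi, hj]
      · rw [shearMatrix, Matrix.updateRow_ne hi, Matrix.one_apply]
        by_cases hj : i = j
        · subst hj
          simp [hi]
        · simp [hi, hj]
    rw [coordChange_X, Finset.sum_congr rfl fun i _ => hterm i, Finset.sum_add_distrib,
      Finset.sum_ite_eq', Finset.sum_ite_eq']
    by_cases h1 : j < s
    · simp [h1, h1.ne]
    · by_cases h2 : j = s
      · simp [h2]
      · simp [h1, h2, add_comm]
  have hθ : ∀ f, split k n r (coordChange β f) = map (θ : _ →+* _) (split k n r f) := by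
    have : ((split k n r).toAlgHom.comp (coordChange β)) =
        (mapAlgHom θ).comp (split k n r).toAlgHom := by
      ext j : 1
      simp only [AlgHom.comp_apply, AlgEquiv.toAlgHom_apply, hβX, mapAlgHom_apply]
      by_cases h1 : (j : ℕ) < r
      · have hj := split_X_low (k := k) (⟨j, h1⟩ : LowVar n r)
        simp only at hj
        rw [if_pos (show j < s from h1), hj, map_X]
      · have hj := split_X_high (k := k) (⟨j, h1⟩ : HighVar n r)
        have hs' := split_X_high (k := k) s'
        have hC : ∀ a, split k n r (C a) = C (C a) := fun a => by
          simpa [highIncl] using split_highIncl (k := k) (n := n) (r := r) (C a)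
        simp only at hj hs'
        rw [if_neg (show ¬ j < s from h1), hj, map_C]
        by_cases h2 : j = s
        · subst h2
          rw [if_pos rfl, map_mul, hC, hs', ← C_mul]
          simp [θ, s']
        · have h3 : (⟨j, h1⟩ : HighVar n r) ≠ s' := fun h => h2 (congrArg Subtype.val h)
          rw [if_neg h2, map_add, map_mul, hC, hs', hj, ← C_mul, ← C_add]
          simp [θ, h3]
    exact fun f => DFunLike.congr_fun this f
  have hincl : highIncl k n r (θ g) = coordChange β (highIncl k n r g) := by
    apply (split k n r).injective
    rw [hθ, split_highIncl, split_highIncl, map_C]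
    rfl
  have hcomp : ∀ m, homogeneousComponent m (highIncl k n r (θ g)) =
      coordChange β (highIncl k n r (homogeneousComponent m g)) := by
    intro m
    rw [hincl, ← coordChange_homogeneousComponent, highIncl, rename_homogeneousComponent]
  have hcoeff : coeff (Finsupp.single s e) (highIncl k n r (θ g)) ≠ 0 := by
    have h1 : coeff (Finsupp.single s e) (highIncl k n r (θ g)) =
        coeff (Finsupp.single s e) (homogeneousComponent e (highIncl k n r (θ g))) := by
      rw [coeff_homogeneousComponent, if_pos (by simp)]
    rw [h1, hcomp, coeff_single_eq_eval_of_isHomogeneous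
      (by rw [← hcomp]; exact homogeneousComponent_isHomogeneous _ _), eval_coordChange]
    convert hbG using 1
    simp only [G, highIncl, eval_rename]
    congr 2
    ext j
    simp [hβ, shearMatrix, Pi.single_apply, show ¬ (j : Fin n) < s from j.2]
  refine ⟨β, ⟨F, hFT, ?_⟩, θ, hθ, ?_, e, ?_⟩
  · rw [hF'] at hbF
    exact hbF
  · intro h
    rw [h, map_zero, coeff_zero] at hcoeff
    exact hcoeff rfl
  · apply toRevLex.injective
    refine le_antisymm ((MonomialOrder.degree_le_iff (m := degRevLex n)).2 fun w hw => ?_)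
      (MonomialOrder.le_degree (m := degRevLex n) (mem_support_iff.2 hcoeff))
    refine toRevLex_le_single (fun i hi => apply_eq_zero_of_mem_support_highIncl hw i hi) ?_
    by_contra! hlt
    rw [mem_support_iff] at hw
    refine hw ?_
    have := coeff_homogeneousComponent (w.degree) (highIncl k n r (θ g)) w
    rw [if_pos rfl, hcomp, homogeneousComponent_eq_zero _ _ hlt, map_zero, map_zero,
      coeff_zero] at this
    exact this.symm

end Generic

section Structure

variable {k : Type*} [Field k] {n : ℕ}

/-! ### Noether position -/

theorem map_coordChange_isPrime {P : Ideal (MvPolynomial (Fin n) k)} (hP : P.IsPrime)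
    (α : GL (Fin n) k) : (P.map (coordChange α)).IsPrime :=
  Ideal.map_isPrime_of_equiv (coordEquiv α)

theorem ringKrullDim_quotient_map_coordChange (P : Ideal (MvPolynomial (Fin n) k))
    (α : GL (Fin n) k) :
    ringKrullDim (MvPolynomial (Fin n) k ⧸ P.map (coordChange α)) =
      ringKrullDim (MvPolynomial (Fin n) k ⧸ P) := by
  have h : P.map (coordChange α) =
      P.map ((coordEquiv α).toRingEquiv : MvPolynomial (Fin n) k →+* MvPolynomial (Fin n) k) := by
    ext f
    rw [mem_map_coordChange_iff, Ideal.mem_map_iff_of_surjective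
      ((coordEquiv α).toRingEquiv : MvPolynomial (Fin n) k →+* MvPolynomial (Fin n) k)
      (coordEquiv α).surjective]
    rfl
  exact (ringKrullDim_eq_of_ringEquiv (Ideal.quotientEquiv P _ (coordEquiv α).toRingEquiv h)).symm

/-- In generic coordinates the last `d` variables are a Noether normalization. -/
theorem noether_position [Infinite k] {d c : ℕ} (hc : c + d = n)
    {P : Ideal (MvPolynomial (Fin n) k)} (hP : P.IsPrime)
    (hd : ringKrullDim (MvPolynomial (Fin n) k ⧸ P) = (d : WithBot ℕ∞))
    {U : Set (GL (Fin n) k)} (hU : IsZariskiOpen U) (hne : U.Nonempty)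
    {E : Set (Fin n →₀ ℕ)} (hE : ∀ α ∈ U, leadExps (P.map (coordChange α)) = E) :
    (∀ i : Fin n, (i : ℕ) < c → ∃ N, Finsupp.single i N ∈ E) ∧
      ∀ α ∈ U, ∀ g, highIncl k n c g ∈ P.map (coordChange α) → g = 0 := by
  classical
  let p : ℕ → Prop := fun r => ∀ i : Fin n, (i : ℕ) < r → ∃ N, Finsupp.single i N ∈ E
  -- With `r` maximal, a nonzero element of the ideal in the remaining variables is impossible: a
  -- shear would produce a power of `x_{r+1}` in the initial ideal, or for `r = n` the element would
  -- be a unit. So the dimension is `n - r`, which forces `r = c`.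
  set r := Nat.findGreatest p n with hr
  have hrn : r ≤ n := Nat.findGreatest_le n
  have hpr : p r := Nat.findGreatest_spec (P := p) (m := 0) (Nat.zero_le n)
    fun i hi => absurd hi (Nat.not_lt_zero _)
  have hinj : ∀ α ∈ U, ∀ g, highIncl k n r g ∈ P.map (coordChange α) → g = 0 := by
    intro α hα g hg
    by_contra h0
    rcases hrn.lt_or_eq with hlt | heq
    · obtain ⟨β, hβ, θ, hθ, hθg, e, he⟩ := exists_generic_shear hU hα hlt h0
      have hmem : Finsupp.single ⟨r, hlt⟩ e ∈ E := by
        rw [← hE _ hβ, map_coordChange_mul]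
        refine ⟨highIncl k n r (θ g), mem_map_coordChange_iff.2 ⟨_, hg, ?_⟩, ?_, he⟩
        · apply (split k n r).injective
          rw [hθ, split_highIncl, split_highIncl, map_C]
          rfl
        · intro h
          exact hθg (rename_injective _ Subtype.val_injective (by simpa [highIncl] using h))
      have hp : p (r + 1) := by
        intro i hi
        rcases Nat.lt_succ_iff_lt_or_eq.1 hi with h | h
        · exact hpr i h
        · exact ⟨e, by rwa [show i = ⟨r, hlt⟩ from Fin.ext h]⟩
      exact absurd (Nat.le_findGreatest hlt hp) (by omega)
    · have : IsEmpty (HighVar n r) := ⟨fun i => i.2 (i.1.2.trans_eq heq.symm)⟩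
      obtain ⟨a, rfl⟩ := C_surjective (R := k) (HighVar n r) g
      have ha : a ≠ 0 := by
        rintro rfl
        exact h0 (map_zero _)
      refine (map_coordChange_isPrime hP α).ne_top
        (Ideal.eq_top_of_isUnit_mem _ hg ?_)
      simpa [highIncl] using ha
  obtain ⟨α, hα⟩ := hne
  have hdim := ringKrullDim_quotient_eq hrn (I := P.map (coordChange α))
    (by rw [hE α hα]; exact hpr) (hinj α hα)
  rw [ringKrullDim_quotient_map_coordChange, hd] at hdim
  have hdr : d = n - r := by exact_mod_cast hdim
  have hrc : r = c := by omega
  rw [← hrc]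
  exact ⟨hpr, hinj⟩

/-! ### Relations between the standard monomials -/

/-- The elements of `Q` whose monomials have a standard part in the first `c` variables. -/
def IsRelation (c : ℕ) (Q : Ideal (MvPolynomial (Fin n) k)) (E : Set (Fin n →₀ ℕ))
    (f : MvPolynomial (Fin n) k) : Prop :=
  f ∈ Q ∧ ∀ w, cut c w ∈ E → coeff (low c w) (split k n c f) = 0

theorem isRelation_of_support {c : ℕ} {Q : Ideal (MvPolynomial (Fin n) k)}
    {E : Set (Fin n →₀ ℕ)} {f : MvPolynomial (Fin n) k} (hf : f ∈ Q)
    (h : ∀ w ∈ f.support, cut c w ∉ E) : IsRelation c Q E f := by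
  refine ⟨hf, fun w hw => ?_⟩
  ext m
  obtain ⟨v, hv1, hv2⟩ := exists_low_high (low c w) m
  rw [← hv1, ← hv2, coeff_split, coeff_zero]
  by_contra h0
  refine h v (mem_support_iff.2 h0) ?_
  rwa [cut_eq_iff_low_eq.2 hv1]

theorem IsRelation.cut_notMem {c : ℕ} {Q : Ideal (MvPolynomial (Fin n) k)}
    {E : Set (Fin n →₀ ℕ)} {f : MvPolynomial (Fin n) k} (hf : IsRelation c Q E f)
    {w : Fin n →₀ ℕ} (hw : w ∈ f.support) : cut c w ∉ E := by
  intro h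
  rw [mem_support_iff, ← coeff_split (r := c), hf.2 w h, coeff_zero] at hw
  exact hw rfl

theorem IsRelation.sub {c : ℕ} {Q : Ideal (MvPolynomial (Fin n) k)}
    {E : Set (Fin n →₀ ℕ)} {f g : MvPolynomial (Fin n) k} (hf : IsRelation c Q E f)
    (hg : IsRelation c Q E g) : IsRelation c Q E (f - g) :=
  ⟨Q.sub_mem hf.1 hg.1, fun w hw => by rw [map_sub, coeff_sub, hf.2 w hw, hg.2 w hw, sub_zero]⟩

theorem coeff_split_highIncl_mul {c : ℕ} (a : MvPolynomial (HighVar n c) k)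
    (f : MvPolynomial (Fin n) k) (v : LowVar n c →₀ ℕ) :
    coeff v (split k n c (highIncl k n c a * f)) = a * coeff v (split k n c f) := by
  rw [map_mul, split_highIncl, coeff_C_mul]

theorem IsRelation.highIncl_mul {c : ℕ} {Q : Ideal (MvPolynomial (Fin n) k)}
    {E : Set (Fin n →₀ ℕ)} {f : MvPolynomial (Fin n) k} (hf : IsRelation c Q E f)
    (a : MvPolynomial (HighVar n c) k) : IsRelation c Q E (highIncl k n c a * f) :=
  ⟨Q.mul_mem_left _ hf.1, fun w hw => by rw [coeff_split_highIncl_mul, hf.2 w hw, mul_zero]⟩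

/-- If only one standard monomial `u` in the first `c` variables has a multiple by the other
variables in the initial ideal, the relations form a free module of rank one. -/
theorem exists_generating_relation {c : ℕ} {Q : Ideal (MvPolynomial (Fin n) k)} (hQ : Q.IsPrime)
    {E : Set (Fin n →₀ ℕ)} (hE : leadExps Q = E)
    (hinj : ∀ g, highIncl k n c g ∈ Q → g = 0) {u : Fin n →₀ ℕ} (hu : cut c u = u) (huE : u ∉ E)
    (huniq : ∀ w ∈ E, cut c w ∉ E → cut c w = u) (hex : ∃ w ∈ E, cut c w = u) :
    ∃ f, IsRelation c Q E f ∧ f ≠ 0 ∧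
      ∀ w ∈ E, cut c w = u → (degRevLex n).degree f ≤ w := by
  have hup : IsUpperSet E := hE ▸ isUpperSet_leadExps Q
  have hincl0 : ∀ a : MvPolynomial (HighVar n c) k, a ≠ 0 → highIncl k n c a ≠ 0 :=
    fun a ha h => ha (hinj a (h ▸ Q.zero_mem))
  let ρ : MvPolynomial (Fin n) k → MvPolynomial (HighVar n c) k :=
    fun f => coeff (low c u) (split k n c f)
  -- The leading exponent of a nonzero relation lies in `E` with standard low part, so this low part
  -- is `u` and the coefficient at `u` cannot vanish.
  have hρ : ∀ f, IsRelation c Q E f → ρ f = 0 → f = 0 := by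
    intro f hf h0
    by_contra hne
    have hsupp := MonomialOrder.degree_mem_support (m := degRevLex n) hne
    have hlead : (degRevLex n).degree f ∈ E := hE ▸ ⟨f, hf.1, hne, rfl⟩
    have hcut := huniq _ hlead (hf.cut_notMem hsupp)
    rw [← hu] at hcut
    rw [mem_support_iff, ← coeff_split (r := c), cut_eq_iff_low_eq.1 hcut] at hsupp
    exact hsupp (by rw [show coeff (low c u) (split k n c f) = 0 from h0, coeff_zero])
  have hlift : ∀ w ∈ E, cut c w = u →
      ∃ f, IsRelation c Q E f ∧ f ≠ 0 ∧ (degRevLex n).degree f = w := by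
    intro w hw hwu
    obtain ⟨g, hg, hg0, hgw, hgD⟩ := exists_reduced_of_mem_leadExps (I := Q)
      (D := {w | cut c w ∈ E}) (fun v hv => hE ▸ hup (cut_le c v) hv) (hE ▸ hw)
      (by rw [Set.mem_ofPred_eq, hwu]; exact huE)
    exact ⟨g, isRelation_of_support hg hgD, hg0, hgw⟩
  let A : Set (MvPolynomial (HighVar n c) k) := {a | ∃ f, IsRelation c Q E f ∧ f ≠ 0 ∧ ρ f = a}
  have hA : A.Nonempty := by
    obtain ⟨w, hw, hwu⟩ := hex
    obtain ⟨f, h1, h2, -⟩ := hlift w hw hwu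
    exact ⟨_, f, h1, h2, rfl⟩
  -- The generator is a relation whose coefficient at `u` is minimal for strict divisibility.
  obtain ⟨_, ⟨f₀, hf₀, hne, rfl⟩, hmin⟩ :=
    (wellFounded_dvdNotUnit (α := MvPolynomial (HighVar n c) k)).has_min A hA
  have ha : ρ f₀ ≠ 0 := fun h => hne (hρ _ hf₀ h)
  have hgen : ∀ f, IsRelation c Q E f → ∃ t, f = highIncl k n c t * f₀ := by
    intro f hf
    -- In lowest terms `ρ f₀ : ρ f = a : b`, so `b f₀ = a f`, and `a`, being coprime to `b`, divides
    -- every coefficient of `f₀`. The quotient `f₀ / a` is again a relation because `Q` is prime and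
    -- contains no nonzero element of `A`. Minimality makes `a` a unit.
    obtain ⟨a, b, h, hcop, hha, hhb⟩ :=
      UniqueFactorizationMonoid.exists_reduced_factors (ρ f₀) ha (ρ f)
    have hrel : highIncl k n c b * f₀ = highIncl k n c a * f := by
      refine sub_eq_zero.1 (hρ _ ((hf₀.highIncl_mul b).sub (hf.highIncl_mul a)) ?_)
      simp only [ρ, map_sub, coeff_sub, coeff_split_highIncl_mul] at hha hhb ⊢
      rw [← hha, ← hhb]
      ring
    have hdvd : C a ∣ split k n c f₀ := by
      rw [C_dvd_iff_dvd_coeff]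
      intro v
      refine hcop.dvd_of_dvd_mul_left (y := b) ⟨coeff v (split k n c f), ?_⟩
      rw [← coeff_split_highIncl_mul, hrel, coeff_split_highIncl_mul]
    obtain ⟨F, hF⟩ := hdvd
    obtain ⟨f₁, rfl⟩ := (split k n c).surjective F
    have hf₀₁ : f₀ = highIncl k n c a * f₁ := by
      apply (split k n c).injective
      rw [map_mul, split_highIncl, hF]
    have ha0 : a ≠ 0 := by
      rintro rfl
      exact ha (by rw [← hha, mul_zero])
    have hf₁ : IsRelation c Q E f₁ := by
      refine ⟨(hQ.mem_or_mem (hf₀₁ ▸ hf₀.1)).resolve_left fun h => ha0 (hinj a h), fun w hw => ?_⟩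
      have := hf₀.2 w hw
      rw [hf₀₁, coeff_split_highIncl_mul] at this
      exact (mul_eq_zero.1 this).resolve_left ha0
    have hρ₁ : ρ f₀ = a * ρ f₁ := by
      change coeff _ (split k n c f₀) = _
      conv_lhs => rw [hf₀₁]
      exact coeff_split_highIncl_mul _ _ _
    have hunit : IsUnit a := by
      by_contra hnu
      have hf₁0 : f₁ ≠ 0 := by
        rintro rfl
        exact hne (by rw [hf₀₁, mul_zero])
      refine hmin (ρ f₁) ⟨f₁, hf₁, hf₁0, rfl⟩ ⟨fun h => hf₁0 (hρ _ hf₁ h), a, hnu, ?_⟩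
      rw [hρ₁, mul_comm]
    obtain ⟨a', ha'⟩ := hunit.exists_left_inv
    refine ⟨a' * b, sub_eq_zero.1 (hρ _ (hf.sub (hf₀.highIncl_mul _)) ?_)⟩
    have hstep : ρ (f - highIncl k n c (a' * b) * f₀) = ρ f - a' * b * ρ f₀ := by
      simp only [ρ, map_sub, coeff_sub, coeff_split_highIncl_mul]
    rw [hstep, ← hha, ← hhb]
    linear_combination (-(h * b)) * ha'
  refine ⟨f₀, hf₀, hne, fun w hw hwu => ?_⟩
  obtain ⟨f, h1, h2, rfl⟩ := hlift w hw hwu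
  obtain ⟨t, rfl⟩ := hgen f h1
  rw [MonomialOrder.degree_mul (left_ne_zero_of_mul h2) hne]
  exact le_add_self

/-- The shape of the generic initial ideal: besides the monomials whose part in the first `c`
variables already belongs to it, it consists of the multiples of one monomial
`u * x_{c+1} ^ e`. -/
theorem exists_generator_shape [Infinite k] {c : ℕ}
    {P : Ideal (MvPolynomial (Fin n) k)} (hP : P.IsPrime)
    {U : Set (GL (Fin n) k)} (hU : IsZariskiOpen U) (hne : U.Nonempty)
    {E : Set (Fin n →₀ ℕ)} (hE : ∀ α ∈ U, leadExps (P.map (coordChange α)) = E)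
    (hinj : ∀ α ∈ U, ∀ g, highIncl k n c g ∈ P.map (coordChange α) → g = 0)
    {u : Fin n →₀ ℕ} (hu : cut c u = u) (huE : u ∉ E)
    (huniq : ∀ w ∈ E, cut c w ∉ E → cut c w = u) (hex : ∃ w ∈ E, cut c w = u) :
    ∃ (hc : c < n) (e : ℕ), e ≠ 0 ∧ u + Finsupp.single ⟨c, hc⟩ e ∈ E ∧
      ∀ w ∈ E, cut c w ∉ E → u + Finsupp.single ⟨c, hc⟩ e ≤ w := by
  have hc : c < n := by
    by_contra hcn
    obtain ⟨w, hw, hwu⟩ := hex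
    have : cut c w = w := Finsupp.filter_eq_self_iff _ _ |>.2 fun i _ => by omega
    exact huE (by rwa [← hwu, this])
  obtain ⟨α, hα⟩ := hne
  obtain ⟨f₀, hf₀, hf₀0, -⟩ := exists_generating_relation (map_coordChange_isPrime hP α) (hE α hα)
    (hinj α hα) hu huE huniq hex
  set g := coeff (low c u) (split k n c f₀) with hg
  have hcutlead : ∀ α ∈ U, ∀ f, IsRelation c (P.map (coordChange α)) E f → f ≠ 0 →
      (degRevLex n).degree f ∈ E ∧ cut c ((degRevLex n).degree f) = u := by
    intro α hα f hf hf0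
    have h1 : (degRevLex n).degree f ∈ E := hE α hα ▸ ⟨f, hf.1, hf0, rfl⟩
    exact ⟨h1, huniq _ h1 (hf.cut_notMem (MonomialOrder.degree_mem_support hf0))⟩
  have hg0 : g ≠ 0 := by
    intro h
    have h1 := MonomialOrder.degree_mem_support (m := degRevLex n) hf₀0
    have h2 := (hcutlead α hα f₀ hf₀ hf₀0).2
    rw [← hu] at h2
    rw [mem_support_iff, ← coeff_split (r := c), cut_eq_iff_low_eq.1 h2, ← hg, h, coeff_zero] at h1
    exact h1 rfl
  -- The shear is chosen for the coefficient `g` of `f₀` at `u`; the sheared relation then has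
  -- leading exponent `u` plus that of `θ g`.
  obtain ⟨β, hβ, θ, hθ, hθg, e, he⟩ := exists_generic_shear hU hα hc hg0
  set s : Fin n := ⟨c, hc⟩ with hs
  set f₁ := coordChange β f₀ with hf₁
  have hcoeff₁ : ∀ v, coeff v (split k n c f₁) = θ (coeff v (split k n c f₀)) := by
    intro v
    rw [hf₁, hθ, coeff_map]
    rfl
  have hrel₁ : IsRelation c (P.map (coordChange (β * α))) E f₁ := by
    refine ⟨?_, fun w hw => by rw [hcoeff₁, hf₀.2 w hw, map_zero]⟩
    rw [map_coordChange_mul]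
    exact mem_map_coordChange_iff.2 ⟨f₀, hf₀.1, rfl⟩
  have hθg₁ : coeff (low c u) (split k n c f₁) = θ g := hcoeff₁ _
  have hf₁0 : f₁ ≠ 0 := by
    intro h
    rw [h, map_zero, coeff_zero] at hθg₁
    exact hθg hθg₁.symm
  have hadd : ∀ t : Fin n →₀ ℕ, low c t = 0 → coeff (u + t) f₁ = coeff t (highIncl k n c (θ g)) := by
    intro t ht
    have h1 : low c (u + t) = low c u := by
      rw [low, Finsupp.subtypeDomain_add]
      exact (congrArg (_ + ·) ht).trans (add_zero _)
    have h2 : high c (u + t) = high c t := by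
      ext i
      have : u i.1 = 0 := by rw [← hu]; exact cut_apply_of_not_lt i.2 u
      simp [this]
    rw [← coeff_split (r := c) f₁, ← coeff_split (r := c) (highIncl k n c (θ g)), h1, h2, hθg₁,
      split_highIncl, ht]
    simp
  have hlead₁ : u + Finsupp.single s e ∈ E := by
    obtain ⟨h1, h2⟩ := hcutlead _ hβ f₁ hrel₁ hf₁0
    have hule : u ≤ (degRevLex n).degree f₁ := h2 ▸ cut_le c _
    obtain ⟨t, ht⟩ := exists_add_of_le hule
    have hlowt : low c t = 0 := by
      ext i
      have h3 := DFunLike.congr_fun h2 i.1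
      rw [ht, cut_apply_of_lt i.2] at h3
      simpa using h3
    have hlows : low c (Finsupp.single s e) = 0 := by
      ext i
      have : s ≠ i.1 := fun h => by
        have := i.2
        rw [← h] at this
        exact lt_irrefl _ this
      simp [this]
    have h4 : t ∈ (highIncl k n c (θ g)).support := by
      rw [mem_support_iff, ← hadd t hlowt, ← ht, ← mem_support_iff]
      exact MonomialOrder.degree_mem_support hf₁0
    have hθ0 : highIncl k n c (θ g) ≠ 0 := by
      intro h
      rw [h] at h4
      simp at h4
    have h5 : toRevLex t ≤ toRevLex (Finsupp.single s e) := by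
      rw [← he]
      exact MonomialOrder.le_degree (m := degRevLex n) h4
    have h6 : u + Finsupp.single s e ∈ f₁.support := by
      rw [mem_support_iff, hadd _ hlows, ← he, ← mem_support_iff]
      exact MonomialOrder.degree_mem_support hθ0
    have h7 : toRevLex (u + Finsupp.single s e) ≤ toRevLex (u + t) := by
      rw [← ht]
      exact MonomialOrder.le_degree (m := degRevLex n) h6
    have h8 : toRevLex (u + t) ≤ toRevLex (u + Finsupp.single s e) := by
      rw [map_add, map_add]
      exact add_le_add_right h5 _
    rw [toRevLex.injective (le_antisymm h7 h8), ← ht]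
    exact h1
  -- The leading exponent of a generating relation lies below `u + single s e`, so its high part is
  -- a power of the same variable. Its exponent `w₀ s`, possibly smaller than `e`, is the one
  -- returned.
  obtain ⟨f₂, hf₂, hf₂0, hle⟩ := exists_generating_relation (map_coordChange_isPrime hP (β * α))
    (hE _ hβ) (hinj _ hβ) hu huE huniq hex
  obtain ⟨h1, h2⟩ := hcutlead _ hβ f₂ hf₂ hf₂0
  set w₀ := (degRevLex n).degree f₂
  have hus : ∀ i, ¬ i < s → u i = 0 := fun i hi => by rw [← hu]; exact cut_apply_of_not_lt hi u
  have hcut : cut c (u + Finsupp.single s e) = u := by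
    ext i
    by_cases hi : (i : ℕ) < c
    · have : s ≠ i := fun h => by rw [← h] at hi; exact lt_irrefl _ hi
      rw [cut_apply_of_lt hi]
      simp [this]
    · rw [cut_apply_of_not_lt hi, hus i hi]
  have h3 := hle _ hlead₁ hcut
  have hw₀ : w₀ = u + Finsupp.single s (w₀ s) := by
    ext i
    rw [Finsupp.add_apply, Finsupp.single_apply]
    rcases lt_trichotomy i s with hi | rfl | hi
    · rw [if_neg hi.ne', add_zero, ← h2]
      exact (cut_apply_of_lt hi w₀).symm
    · rw [if_pos rfl, hus _ (lt_irrefl _), zero_add]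
    · have h4 := h3 i
      rw [Finsupp.add_apply, Finsupp.single_apply, if_neg hi.ne, hus i (not_lt.2 hi.le)] at h4
      rw [if_neg hi.ne, hus i (not_lt.2 hi.le)]
      omega
  refine ⟨hc, w₀ s, fun h0 => huE ?_, ?_, fun w hw hwE => ?_⟩
  · rw [h0, Finsupp.single_zero, add_zero] at hw₀
    rwa [← hw₀]
  · rw [← hw₀]
    exact h1
  · rw [← hw₀]
    exact hle w hw (huniq w hw hwE)

end Structure

/-! ### A maximal regular sequence -/

section RegularSequence

variable {k : Type*} [Field k] {n : ℕ}

variable (k n) in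
/-- The ideal generated by the variables after the first `j`. -/
def tailIdeal (j : ℕ) : Ideal (MvPolynomial (Fin n) k) := Ideal.span (X '' {l : Fin n | j ≤ l})

theorem mem_tailIdeal_iff {j : ℕ} {f : MvPolynomial (Fin n) k} :
    f ∈ tailIdeal k n j ↔ ∀ w ∈ f.support, ∃ l : Fin n, j ≤ l ∧ w l ≠ 0 :=
  mem_ideal_span_X_image

theorem X_mem_tailIdeal {j : ℕ} {l : Fin n} (h : j ≤ l) : X l ∈ tailIdeal k n j :=
  Ideal.subset_span ⟨l, h, rfl⟩

theorem tailIdeal_self : tailIdeal k n n = ⊥ := by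
  rw [tailIdeal, show {l : Fin n | n ≤ (l : ℕ)} = ∅ from
    Set.eq_empty_of_forall_notMem fun l hl => absurd l.2 (not_lt.2 hl), Set.image_empty,
    Ideal.span_empty]

theorem tailIdeal_succ_sup {j : ℕ} (hj : j < n) :
    tailIdeal k n (j + 1) ⊔ Ideal.span {X ⟨j, hj⟩} = tailIdeal k n j := by
  rw [tailIdeal, tailIdeal, ← Ideal.span_union, ← Set.image_singleton, ← Set.image_union]
  congr 2
  ext l
  simp only [Set.mem_union, Set.mem_ofPred_eq, Set.mem_singleton_iff, Fin.ext_iff]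
  omega

/-- The defining feature of the reverse lexicographic order: the last variable that occurs in `v`
decides. -/
theorem toRevLex_lt_of_tail {j : ℕ} {v w : Fin n →₀ ℕ} (hdeg : v.degree = w.degree)
    (hv : ∃ l : Fin n, j ≤ l ∧ v l ≠ 0) (hw : ∀ l : Fin n, j ≤ l → w l = 0) :
    toRevLex v < toRevLex w := by
  obtain ⟨l, hjl, hl⟩ := hv
  have hne : v.support.Nonempty := ⟨l, Finsupp.mem_support_iff.2 hl⟩
  have hle : ∀ i, v i ≠ 0 → i ≤ v.support.max' hne :=
    fun i hi => Finset.le_max' _ _ (Finsupp.mem_support_iff.2 hi)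
  have hmem := Finsupp.mem_support_iff.1 (Finset.max'_mem _ hne)
  set i := v.support.max' hne
  have hji : j ≤ i := hjl.trans (hle l hl)
  refine RevLex.lt_iff.2 (Or.inr ⟨hdeg, i, fun a ha => ?_, ?_⟩)
  · rw [hw a (hji.trans (Fin.le_def.1 ha.le))]
    by_contra h
    exact absurd (hle a h) (not_le.2 ha)
  · rw [hw i hji]
    exact Nat.pos_of_ne_zero hmem

open Classical in
/-- The sum of the terms of `f` that involve only the first `j` variables. -/
def restrictVars (j : ℕ) (f : MvPolynomial (Fin n) k) : MvPolynomial (Fin n) k :=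
  ∑ w ∈ f.support with ∀ l : Fin n, j ≤ l → w l = 0, monomial w (coeff w f)

open Classical in
theorem coeff_restrictVars (j : ℕ) (f : MvPolynomial (Fin n) k) (w : Fin n →₀ ℕ) :
    coeff w (restrictVars j f) = if ∀ l : Fin n, j ≤ l → w l = 0 then coeff w f else 0 := by
  rw [restrictVars, coeff_sum]
  simp only [coeff_monomial]
  rw [Finset.sum_ite_eq']
  simp only [Finset.mem_filter, mem_support_iff]
  split_ifs <;> simp_all

theorem sub_restrictVars_mem (j : ℕ) (f : MvPolynomial (Fin n) k) :
    f - restrictVars j f ∈ tailIdeal k n j := by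
  classical
  rw [mem_tailIdeal_iff]
  intro w hw
  by_contra! h
  rw [mem_support_iff, coeff_sub, coeff_restrictVars, if_pos h, sub_self] at hw
  exact hw rfl

theorem mem_support_restrictVars {j : ℕ} {f : MvPolynomial (Fin n) k} {w : Fin n →₀ ℕ}
    (hw : w ∈ (restrictVars j f).support) :
    w ∈ f.support ∧ ∀ l : Fin n, j ≤ l → w l = 0 := by
  classical
  rw [mem_support_iff, coeff_restrictVars] at hw
  split_ifs at hw with h
  · exact ⟨mem_support_iff.2 hw, h⟩
  · exact absurd rfl hw

/-- In the reverse lexicographic order, initial ideals are compatible with setting the last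
variables to zero. -/
theorem degree_mem_leadExps_of_mem_sup_tailIdeal {Q : Ideal (MvPolynomial (Fin n) k)}
    (hQ : ComponentClosed Q) {j : ℕ} {f : MvPolynomial (Fin n) k}
    (hf : f ∈ Q ⊔ tailIdeal k n j) (h0 : f ≠ 0)
    (hfree : ∀ w ∈ f.support, ∀ l : Fin n, j ≤ l → w l = 0) :
    (degRevLex n).degree f ∈ leadExps Q := by
  obtain ⟨q, hq, h, hh, hqh⟩ := Submodule.mem_sup.1 hf
  rw [mem_tailIdeal_iff] at hh
  set w := (degRevLex n).degree f with hw
  have hwf : w ∈ f.support := MonomialOrder.degree_mem_support h0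
  have hhw : coeff w h = 0 := by
    by_contra hne
    obtain ⟨l, hl, hwl⟩ := hh w (mem_support_iff.2 hne)
    exact hwl (hfree w hwf l hl)
  -- Tail monomials are known to be smaller only in equal degree, so `q` is replaced by its
  -- component in the degree of `w`.
  set p := homogeneousComponent w.degree q with hp
  have hpw : coeff w p ≠ 0 := by
    rw [hp, coeff_homogeneousComponent, if_pos rfl]
    rw [mem_support_iff, ← hqh, coeff_add, hhw, add_zero] at hwf
    exact hwf
  have hp0 : p ≠ 0 := fun h => hpw (by rw [h, coeff_zero])
  refine ⟨p, hQ q hq _, hp0, toRevLex.injective (le_antisymm ?_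
    (MonomialOrder.le_degree (m := degRevLex n) (mem_support_iff.2 hpw)))⟩
  refine (MonomialOrder.degree_le_iff (m := degRevLex n)).2 fun v hv => ?_
  rw [mem_support_iff, hp, coeff_homogeneousComponent] at hv
  split_ifs at hv with hdeg
  · by_cases hvf : v ∈ f.support
    · exact MonomialOrder.le_degree (m := degRevLex n) hvf
    · have hvh : coeff v h ≠ 0 := by
        rw [notMem_support_iff, ← hqh, coeff_add] at hvf
        intro h'
        rw [h', add_zero] at hvf
        exact hv hvf
      exact (toRevLex_lt_of_tail hdeg (hh v (mem_support_iff.2 hvh)) (hfree w hwf)).le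
  · exact absurd rfl hv

theorem exists_isHomogeneous_of_mem_leadExps {Q : Ideal (MvPolynomial (Fin n) k)}
    (hQ : ComponentClosed Q) {w : Fin n →₀ ℕ} (hw : w ∈ leadExps Q) :
    ∃ f ∈ Q, coeff w f ≠ 0 ∧ ∀ v ∈ f.support, v.degree = w.degree ∧ toRevLex v ≤ toRevLex w := by
  obtain ⟨f, hf, h0, rfl⟩ := hw
  refine ⟨_, hQ f hf ((degRevLex n).degree f).degree, ?_, fun v hv => ?_⟩
  · rw [coeff_homogeneousComponent, if_pos rfl]
    exact MonomialOrder.coeff_degree_ne_zero_iff.2 h0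
  · rw [mem_support_iff, coeff_homogeneousComponent] at hv
    split_ifs at hv with hdeg
    · exact ⟨hdeg, MonomialOrder.le_degree (m := degRevLex n) (mem_support_iff.2 hv)⟩
    · exact absurd rfl hv

/-- Modulo `Q` and the later variables, `f` may be replaced by a polynomial `g'` with standard
monomials and none of the later variables. If `g' ≠ 0`, the leading exponent of `X j * g'` belongs
to `Q`, and cancelling `X j` contradicts standardness. -/
theorem regularMod_X {Q : Ideal (MvPolynomial (Fin n) k)} (hQ : ComponentClosed Q) {j : Fin n}
    (hj : ∀ w, w + Finsupp.single j 1 ∈ leadExps Q → w ∈ leadExps Q) :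
    RegularMod (Q ⊔ tailIdeal k n (j + 1)) (X j) := by
  intro f hf
  obtain ⟨g, hfg, hg, -⟩ := exists_reduction (I := Q) (D := leadExps Q) le_rfl f
  set g' := restrictVars (j + 1) g
  have hfg' : f - g' ∈ Q ⊔ tailIdeal k n (j + 1) := by
    rw [← sub_add_sub_cancel f g g']
    exact Submodule.add_mem_sup hfg (sub_restrictVars_mem _ _)
  suffices h : g' = 0 by rwa [h, sub_zero] at hfg'
  by_contra h0
  have hX : X j * g' ∈ Q ⊔ tailIdeal k n (j + 1) := by
    have := Ideal.sub_mem _ hf (Ideal.mul_mem_left _ (X j) hfg')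
    rwa [← mul_sub, sub_sub_cancel] at this
  have hX0 : (X j : MvPolynomial (Fin n) k) ≠ 0 := X_ne_zero j
  have hlead := degree_mem_leadExps_of_mem_sup_tailIdeal hQ hX (mul_ne_zero hX0 h0) (by
    intro w hw l hl
    rw [support_X_mul, Finset.mem_map] at hw
    obtain ⟨v, hv, rfl⟩ := hw
    have hne : j ≠ l := fun h => by subst h; omega
    have := (mem_support_restrictVars hv).2 l hl
    simpa [Finsupp.single_apply, hne] using this)
  rw [MonomialOrder.degree_mul hX0 h0, MonomialOrder.degree_X, add_comm] at hlead
  exact hg _ (mem_support_restrictVars (MonomialOrder.degree_mem_support h0)).1 (hj _ hlead)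

/-- Descending induction on `i`: a form in `Q` with leading monomial `x_i^N` has all its other
monomials divisible by later variables, so `x_i^N` lies in the radical. -/
theorem X_mem_radical {Q : Ideal (MvPolynomial (Fin n) k)} (hQ : ComponentClosed Q) {c : ℕ}
    (hpow : ∀ i : Fin n, (i : ℕ) < c → ∃ N, Finsupp.single i N ∈ leadExps Q) (i : Fin n) :
    X i ∈ (Q ⊔ tailIdeal k n c).radical := by
  induction i using WellFoundedGT.induction with
  | ind i ih =>
  by_cases hic : c ≤ i
  · exact Ideal.le_radical (Ideal.mem_sup_right (X_mem_tailIdeal hic))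
  obtain ⟨N, hN⟩ := hpow i (not_le.1 hic)
  obtain ⟨f, hf, ha, hsupp⟩ := exists_isHomogeneous_of_mem_leadExps hQ hN
  set a := coeff (Finsupp.single i N) f
  have hrest : f - monomial (Finsupp.single i N) a ∈ (Q ⊔ tailIdeal k n c).radical := by
    have hle : tailIdeal k n (i + 1) ≤ (Q ⊔ tailIdeal k n c).radical := by
      rw [tailIdeal, Ideal.span_le]
      rintro _ ⟨l, hl, rfl⟩
      exact ih l (Fin.lt_def.2 hl)
    refine hle (mem_tailIdeal_iff.2 fun w hw => ?_)
    classical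
    have hne : w ≠ Finsupp.single i N := by
      rintro rfl
      rw [mem_support_iff, coeff_sub, coeff_monomial, if_pos rfl, sub_self] at hw
      exact hw rfl
    have hwf : w ∈ f.support := by
      rw [mem_support_iff, coeff_sub, coeff_monomial, if_neg (Ne.symm hne), sub_zero] at hw
      exact mem_support_iff.2 hw
    obtain ⟨hdeg, hlew⟩ := hsupp w hwf
    by_contra! hfree
    have hlt : toRevLex w < toRevLex (Finsupp.single i N) :=
      lt_of_le_of_ne hlew fun h => hne (toRevLex.injective h)
    rcases RevLex.lt_iff.1 hlt with h | ⟨-, l, h1, h2⟩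
    · omega
    · rw [Finsupp.degree_single, Finsupp.degree_eq_sum] at hdeg
      rcases lt_trichotomy l i with hl | rfl | hl
      · have h3 : w i = N := by rw [h1 i hl, Finsupp.single_eq_same]
        have h4 : w l + w i ≤ ∑ x, w x := by
          rw [← Finset.sum_pair hl.ne]
          exact Finset.sum_le_sum_of_subset (Finset.subset_univ _)
        omega
      · rw [Finsupp.single_eq_same] at h2
        have := Finset.single_le_sum (f := w) (fun x _ => Nat.zero_le _) (Finset.mem_univ l)
        omega
      · rw [hfree l (Fin.lt_def.1 hl)] at h2
        omega
  have hmon : monomial (Finsupp.single i N) a ∈ (Q ⊔ tailIdeal k n c).radical := by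
    have := Ideal.sub_mem _ (Ideal.le_radical (Ideal.mem_sup_left hf)) hrest
    rwa [sub_sub_cancel] at this
  have hXN : (X i : MvPolynomial (Fin n) k) ^ N ∈ (Q ⊔ tailIdeal k n c).radical := by
    have := Ideal.mul_mem_left _ (C a⁻¹) hmon
    rwa [C_mul_monomial, inv_mul_cancel₀ ha, ← X_pow_eq_monomial] at this
  rw [← Ideal.radical_idem]
  exact ⟨N, hXN⟩

/-- A form of `Q` with leading monomial `u * x_{c+1}^e`, stripped of the variables after `x_{c+1}`,
is divisible by `x_{c+1}`. The quotient `τ` is not in the ideal, since `u * x_{c+1}^(e-1)` is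
standard, but `x_{c+1} τ` is. -/
theorem hasSocle_of_shape {Q : Ideal (MvPolynomial (Fin n) k)} (hQ : ComponentClosed Q) {c : ℕ}
    (hpow : ∀ i : Fin n, (i : ℕ) < c → ∃ N, Finsupp.single i N ∈ leadExps Q)
    (hc : c < n) {u : Fin n →₀ ℕ} (hu : cut c u = u) (huE : u ∉ leadExps Q) {e : ℕ} (he : e ≠ 0)
    (hmem : u + Finsupp.single ⟨c, hc⟩ e ∈ leadExps Q)
    (hshape : ∀ w ∈ leadExps Q, cut c w ∉ leadExps Q → u + Finsupp.single ⟨c, hc⟩ e ≤ w) :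
    HasSocle (idealOfVars (Fin n) k) (Q ⊔ tailIdeal k n (c + 1)) := by
  classical
  set s : Fin n := ⟨c, hc⟩ with hs
  set w₀ := u + Finsupp.single s e with hw₀
  have hus : ∀ i, ¬ i < s → u i = 0 := fun i hi => by rw [← hu]; exact cut_apply_of_not_lt hi u
  have hw₀free : ∀ l : Fin n, c + 1 ≤ l → w₀ l = 0 := by
    intro l hl
    have hsl : s ≠ l := fun h => by rw [← h] at hl; exact absurd hl (by simp [hs])
    rw [hw₀, Finsupp.add_apply, hus l (by rw [Fin.lt_def, hs]; simp; omega), Finsupp.single_apply,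
      if_neg hsl, add_zero]
  have hw₀s : w₀ s = e := by
    rw [hw₀, Finsupp.add_apply, hus s (lt_irrefl _), Finsupp.single_eq_same, zero_add]
  obtain ⟨f, hf, hcoeff, hsupp⟩ := exists_isHomogeneous_of_mem_leadExps hQ hmem
  set h := restrictVars (c + 1) f with hh
  have hh₀ : coeff w₀ h ≠ 0 := by rwa [hh, coeff_restrictVars, if_pos hw₀free]
  have hh0 : h ≠ 0 := fun h' => hh₀ (by rw [h', coeff_zero])
  have hX0 : (X s : MvPolynomial (Fin n) k) ≠ 0 := X_ne_zero s
  -- A monomial of the same degree in the first `c + 1` variables that is reverse lexicographically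
  -- at most `w₀` has an exponent at least `e` at `x_{c+1}`.
  have hdvd : X s ∣ h := by
    rw [h.as_sum]
    refine Finset.dvd_sum fun w hw => ?_
    rw [X_dvd_monomial]
    right
    obtain ⟨hwf, hfree⟩ := mem_support_restrictVars hw
    obtain ⟨-, hle⟩ := hsupp w hwf
    rcases hle.eq_or_lt with heq | hlt
    · rw [toRevLex.injective heq, hw₀s]
      exact he
    · rcases RevLex.lt_iff.1 hlt with hd | ⟨-, i, h1, h2⟩
      · have := (hsupp w hwf).1
        omega
      · rcases lt_trichotomy i s with hi | rfl | hi
        · rw [h1 s hi, hw₀s]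
          exact he
        · omega
        · rw [hfree i (Fin.lt_def.1 hi)] at h2
          omega
  obtain ⟨τ, hτ⟩ := hdvd
  have hτ0 : τ ≠ 0 := by
    rintro rfl
    exact hh0 (by rw [hτ, mul_zero])
  have hdeg : (degRevLex n).degree h = w₀ := by
    apply toRevLex.injective
    refine le_antisymm ((MonomialOrder.degree_le_iff (m := degRevLex n)).2 fun v hv => ?_)
      (MonomialOrder.le_degree (m := degRevLex n) (mem_support_iff.2 hh₀))
    exact (hsupp v (mem_support_restrictVars hv).1).2
  have hdegτ : Finsupp.single s 1 + (degRevLex n).degree τ = w₀ := by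
    rw [← hdeg, hτ, MonomialOrder.degree_mul hX0 hτ0, MonomialOrder.degree_X]
  have hτI : τ ∉ Q ⊔ tailIdeal k n (c + 1) := by
    intro hmemτ
    have hlead := degree_mem_leadExps_of_mem_sup_tailIdeal hQ hmemτ hτ0 (by
      intro w hw l hl
      have hw' : Finsupp.single s 1 + w ∈ h.support := by
        rw [hτ, support_X_mul]
        exact Finset.mem_map_of_mem _ hw
      have := (mem_support_restrictVars hw').2 l hl
      rw [Finsupp.add_apply] at this
      omega)
    have hcut : cut c ((degRevLex n).degree τ) = u := by
      ext i
      by_cases hi : (i : ℕ) < c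
      · have hne : s ≠ i := fun h => by rw [← h] at hi; exact lt_irrefl _ hi
        have := DFunLike.congr_fun hdegτ i
        rw [cut_apply_of_lt hi]
        simpa [hw₀, Finsupp.single_apply, hne] using this
      · rw [cut_apply_of_not_lt hi, hus i hi]
    have h1 := hshape _ hlead (by rwa [hcut]) s
    have h2 := DFunLike.congr_fun hdegτ s
    rw [Finsupp.add_apply, Finsupp.single_eq_same] at h2
    omega
  have hXτ : X s * τ ∈ Q ⊔ tailIdeal k n (c + 1) := by
    rw [← hτ]
    have := Submodule.sub_mem_sup hf (sub_restrictVars_mem (c + 1) f)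
    rwa [sub_sub_cancel] at this
  -- `τ` is killed by `Q` and all of `x_{c+1}, ..., x_n`, an ideal whose radical contains every
  -- variable by Noether position.
  refine hasSocle_of_le_radical (K := Q ⊔ tailIdeal k n c) hτI (fun a ha => ?_) ?_
  · rw [← tailIdeal_succ_sup hc, ← sup_assoc] at ha
    obtain ⟨b, hb⟩ := mem_sup_span_singleton.1 ha
    have := Ideal.add_mem _ (Ideal.mul_mem_right τ _ hb) (Ideal.mul_mem_left _ b hXτ)
    convert this using 1
    ring
  · rw [idealOfVars, Ideal.span_le]
    rintro _ ⟨i, rfl⟩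
    exact X_mem_radical hQ hpow i

theorem hasMaximalRegularSequence_of_shape {Q : Ideal (MvPolynomial (Fin n) k)}
    (hQ : ComponentClosed Q) {c : ℕ}
    (hpow : ∀ i : Fin n, (i : ℕ) < c → ∃ N, Finsupp.single i N ∈ leadExps Q)
    (hc : c < n) {u : Fin n →₀ ℕ} (hu : cut c u = u) (huE : u ∉ leadExps Q) {e : ℕ} (he : e ≠ 0)
    (hmem : u + Finsupp.single ⟨c, hc⟩ e ∈ leadExps Q)
    (hshape : ∀ w ∈ leadExps Q, cut c w ∉ leadExps Q → u + Finsupp.single ⟨c, hc⟩ e ≤ w) :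
    HasMaximalRegularSequence (idealOfVars (Fin n) k) (n - (c + 1)) Q := by
  -- The sequence is built from its end: `t = 0` is the quotient with nonzero socle, and each step
  -- restores one variable until the tail ideal is zero.
  have key : ∀ t, c + 1 + t ≤ n →
      HasMaximalRegularSequence (idealOfVars (Fin n) k) t (Q ⊔ tailIdeal k n (c + 1 + t)) := by
    intro t
    induction t with
    | zero => exact fun _ => hasSocle_of_shape hQ hpow hc hu huE he hmem hshape
    | succ t ih =>
      intro ht
      have htn : c + 1 + t < n := by omega
      refine ⟨X ⟨c + 1 + t, htn⟩, Ideal.subset_span ⟨_, rfl⟩, ?_, ?_⟩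
      · refine regularMod_X hQ (j := ⟨c + 1 + t, htn⟩) fun w hw => ?_
        have hcut : cut c (w + Finsupp.single ⟨c + 1 + t, htn⟩ 1) = cut c w := by
          ext i
          by_cases hi : (i : ℕ) < c
          · have hne : (⟨c + 1 + t, htn⟩ : Fin n) ≠ i := fun h => by
              rw [← h] at hi
              simp at hi
              omega
            rw [cut_apply_of_lt hi, cut_apply_of_lt hi]
            simp [hne]
          · rw [cut_apply_of_not_lt hi, cut_apply_of_not_lt hi]
        by_cases hwE : cut c w ∈ leadExps Q
        · exact isUpperSet_leadExps Q (cut_le c w) hwE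
        · refine isUpperSet_leadExps Q (fun i => ?_) hmem
          have h1 := hshape _ hw (by rwa [hcut]) i
          by_cases hi : i = ⟨c + 1 + t, htn⟩
          · have hui : u i = 0 := by
              rw [← hu]
              exact cut_apply_of_not_lt (by rw [hi]; simp; omega) u
            have hne : (⟨c, hc⟩ : Fin n) ≠ i := fun h => by
              rw [hi, Fin.ext_iff] at h
              simp at h
              omega
            rw [Finsupp.add_apply, hui, Finsupp.single_apply, if_neg hne]
            exact Nat.zero_le _
          · have h0 : Finsupp.single (⟨c + 1 + t, htn⟩ : Fin n) 1 i = 0 := by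
              rw [Finsupp.single_apply, if_neg (Ne.symm hi)]
            rwa [Finsupp.add_apply w, h0, add_zero] at h1
      · rw [sup_assoc, show c + 1 + (t + 1) = c + 1 + t + 1 from rfl, tailIdeal_succ_sup htn]
        exact ih (by omega)
  have := key (n - (c + 1)) (by omega)
  rwa [show c + 1 + (n - (c + 1)) = n by omega, tailIdeal_self, sup_bot_eq] at this

end RegularSequence

/-! ### Transport of the depth to `P`, and the shape of the generic initial ideal -/

section Main

variable {k : Type*} [Field k] {n : ℕ}

theorem deg_bot : deg (⊥ : Ideal (MvPolynomial (Fin n) k)) = 1 := by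
  have h := deg_span_monomial (k := k) (n := n) (E := ∅) isUpperSet_empty (Nat.zero_le n)
    (B := {0}) (by simp [cut_zero]) (fun w => by
      have : cut 0 w = 0 := by
        ext i
        exact cut_apply_of_not_lt (Nat.not_lt_zero _) w
      simp [this])
  simpa using h

theorem Phi_bot (r : ℕ) : Phi r (⊥ : Ideal (MvPolynomial (Fin n) k)) = ⊥ := by
  rw [Phi, Ideal.span_eq_bot]
  rintro _ ⟨u, hu, rfl⟩
  have h0 : monomial u (1 : k) ∈ (⊥ : Ideal (MvPolynomial (Fin n) k)) := hu.1
  simp at h0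

theorem le_idealOfVars {P : Ideal (MvPolynomial (Fin n) k)} (hP : P ≠ ⊤) (h : ComponentClosed P) :
    P ≤ idealOfVars (Fin n) k := by
  intro f hf
  rw [mem_idealOfVars_iff]
  by_contra h0
  have hC := h f hf 0
  rw [homogeneousComponent_zero] at hC
  exact hP (Ideal.eq_top_of_isUnit_mem _ hC ((IsUnit.mk0 _ h0).map C))

theorem depthQuot_map_coordChange {P : Ideal (MvPolynomial (Fin n) k)} (hP : P ≠ ⊤)
    (h : ComponentClosed P) (α : GL (Fin n) k) {t : ℕ}
    (ht : HasMaximalRegularSequence (idealOfVars (Fin n) k) t (P.map (coordChange α))) :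
    depthQuot P = t := by
  refine depthQuot_eq_of_hasMaximalRegularSequence (le_idealOfVars hP h) ?_
  have h1 := ht.map_equiv (coordEquiv α⁻¹).toRingEquiv
    (fun a => (coordChange_mem_idealOfVars_iff α⁻¹ a).symm)
  have h2 : (P.map (coordChange α)).map (coordEquiv α⁻¹).toRingEquiv = P := by
    change (P.map (coordChange α)).map (coordChange α⁻¹) = P
    rw [← map_coordChange_mul, inv_mul_cancel, coordChange_one]
    exact Ideal.map_id P
  rwa [h2] at h1

theorem cut_add_single {c : ℕ} {u : Fin n →₀ ℕ} (hu : cut c u = u) (hc : c < n) (e : ℕ) :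
    cut c (u + Finsupp.single ⟨c, hc⟩ e) = u := by
  have h : cut c (Finsupp.single (⟨c, hc⟩ : Fin n) e) = 0 :=
    Finsupp.filter_single_of_neg (fun i : Fin n => (i : ℕ) < c) (lt_irrefl c)
  have hadd : cut c (u + Finsupp.single ⟨c, hc⟩ e) = cut c u + cut c (Finsupp.single ⟨c, hc⟩ e) :=
    Finsupp.filter_add
  rw [hadd, hu, h, add_zero]

/-- If dehomogenizing removes exactly one standard monomial `u`, then `u` is the only standard
monomial that is the part in the first `c` variables of an exponent in `E`. -/
theorem exists_unique_low {c : ℕ} {E : Set (Fin n →₀ ℕ)} (hE : IsUpperSet E)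
    (hfin : (lowStandard c E).Finite)
    (hcard : (lowStandard c (phiExps c E)).ncard + 1 = (lowStandard c E).ncard) :
    ∃ u, cut c u = u ∧ u ∉ E ∧ (∀ w ∈ E, cut c w ∉ E → cut c w = u) ∧ ∃ w ∈ E, cut c w = u := by
  have hsub : lowStandard c (phiExps c E) ⊆ lowStandard c E :=
    fun v hv => ⟨hv.1, fun h => hv.2 (subset_phiExps c E h)⟩
  have h1 : (lowStandard c E \ lowStandard c (phiExps c E)).ncard = 1 := by
    have := Set.ncard_sdiff_add_ncard_of_subset hsub hfin
    omega
  obtain ⟨u, hu⟩ := Set.ncard_eq_one.1 h1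
  have huD : u ∈ lowStandard c E \ lowStandard c (phiExps c E) := hu ▸ rfl
  refine ⟨u, huD.1.1, huD.1.2, fun w hw hcw => ?_, ?_⟩
  · have : cut c w ∈ lowStandard c E \ lowStandard c (phiExps c E) :=
      ⟨⟨cut_cut c w, hcw⟩, fun h => h.2 ⟨w, hw, le_rfl⟩⟩
    rwa [hu] at this
  · have : u ∈ phiExps c E := by
      by_contra h
      exact huD.2 ⟨huD.1.1, h⟩
    -- If `u = cut c t + v` with `t ∈ E`, then `t + v` lies in `E` and has low part exactly `u`.
    obtain ⟨t, ht, htu⟩ := this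
    obtain ⟨v, hv⟩ := exists_add_of_le htu
    refine ⟨t + v, hE le_self_add ht, ?_⟩
    have h2 : cut c (t + v) = cut c t + cut c v := Finsupp.filter_add
    have h3 : cut c (cut c t + v) = cut c (cut c t) + cut c v := Finsupp.filter_add
    rw [h2, ← cut_cut c t, ← h3, ← hv, huD.1.1]

theorem monomial_mem_supported {s : Set (Fin n)} {w : Fin n →₀ ℕ} (h : ∀ i, w i ≠ 0 → i ∈ s) :
    monomial w (1 : k) ∈ supported k s := by
  rw [mem_supported, vars_monomial one_ne_zero]
  exact fun i hi => h i (Finsupp.mem_support_iff.1 hi)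

/-- Each exponent `w` of `E` lies above an element of `E` supported on the first `c + 1` variables:
its own low part, or the exponent of `u * x_{c+1}^e`. -/
theorem span_monomial_eq_span_inter_supported {c : ℕ} {E : Set (Fin n →₀ ℕ)}
    {u : Fin n →₀ ℕ} (hu : cut c u = u) (hc : c < n) {e : ℕ}
    (hmem : u + Finsupp.single ⟨c, hc⟩ e ∈ E)
    (hshape : ∀ w ∈ E, cut c w ∉ E → u + Finsupp.single ⟨c, hc⟩ e ≤ w) :
    Ideal.span ((fun w => monomial w (1 : k)) '' E) =
      Ideal.span ((Ideal.span ((fun w => monomial w (1 : k)) '' E) : Set (MvPolynomial (Fin n) k)) ∩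
        (supported k {i : Fin n | (i : ℕ) < c + 1} : Set (MvPolynomial (Fin n) k))) := by
  refine le_antisymm (Ideal.span_le.2 ?_) (Ideal.span_le.2 Set.inter_subset_left)
  have key : ∀ v ∈ E, (∀ i, v i ≠ 0 → (i : ℕ) < c + 1) → ∀ w, v ≤ w → monomial w (1 : k) ∈
      Ideal.span ((Ideal.span ((fun w => monomial w (1 : k)) '' E) :
        Set (MvPolynomial (Fin n) k)) ∩
        (supported k {i : Fin n | (i : ℕ) < c + 1} : Set (MvPolynomial (Fin n) k))) := by
    intro v hv hvs w hvw
    obtain ⟨t, rfl⟩ := exists_add_of_le hvw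
    have hmul : monomial (v + t) (1 : k) = monomial v 1 * monomial t 1 := by
      rw [monomial_mul, mul_one]
    rw [hmul]
    exact Ideal.mul_mem_right _ _ (Ideal.subset_span
      ⟨Ideal.subset_span ⟨v, hv, rfl⟩, monomial_mem_supported hvs⟩)
  rintro _ ⟨w, hw, rfl⟩
  by_cases h : cut c w ∈ E
  · refine key _ h (fun i hi => ?_) w (cut_le c w)
    by_contra hlt
    exact hi (cut_apply_of_not_lt (by omega) w)
  · refine key _ hmem (fun i hi => ?_) w (hshape w hw h)
    by_contra hlt
    have h1 : u i = 0 := by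
      rw [← hu]
      exact cut_apply_of_not_lt (by omega) u
    have hne : (⟨c, hc⟩ : Fin n) ≠ i := fun h => hlt (by rw [← h]; simp)
    exact hi (by rw [Finsupp.add_apply, h1, Finsupp.single_apply, if_neg hne, add_zero])

/-- Makes a separate existence proof for generic initial ideals superfluous: the default value `⊥`
gives degree `1` on both sides. -/
theorem isGin_gin_of_deg_ne {P : Ideal (MvPolynomial (Fin n) k)} {c : ℕ}
    (h : deg (Phi c (gin P)) ≠ deg ((gin P).map (piHom k n c))) : IsGin P (gin P) := by
  by_cases hg : ∃ J, IsGin P J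
  · rw [gin, dif_pos hg]
    exact hg.choose_spec
  · rw [gin, dif_neg hg, Phi_bot, Ideal.map_bot, deg_bot, deg_bot] at h
    exact absurd rfl h

end Main

end GinDepth

end

theorem mainTheorem2 {k : Type*} [Field k] [Infinite k] (n d c : ℕ)
    (P : Ideal (MvPolynomial (Fin n) k)) (hP : P.IsPrime)
    (hhom : GinDepth.IsHomogeneousIdeal P)
    (hd : ringKrullDim (MvPolynomial (Fin n) k ⧸ P) = (d : WithBot ℕ∞))
    (hc : c + d = n)
    (J : Ideal (MvPolynomial (Fin n) k)) (hJ : J = GinDepth.gin P)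
    (hdeg : GinDepth.deg (GinDepth.Phi c J) + 1 =
      GinDepth.deg (J.map (GinDepth.piHom k n c))) :
    J = Ideal.span ((J : Set (MvPolynomial (Fin n) k)) ∩
        (MvPolynomial.supported k {i : Fin n | (i : ℕ) < c + 1} :
          Set (MvPolynomial (Fin n) k))) ∧
      (∃ i : Fin n, (i : ℕ) = c ∧ ∃ u ∈ GinDepth.minGens J, u i ≠ 0) ∧
      GinDepth.depthQuot P + 1 = (d : ℕ∞) ∧
      GinDepth.IsAlmostCohenMacaulay P := by
  have hgin : GinDepth.IsGin P J := by
    rw [hJ] at hdeg ⊢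
    exact GinDepth.isGin_gin_of_deg_ne (c := c) (by omega)
  obtain ⟨U, hU, ⟨α, hα⟩, hUJ⟩ := hgin
  set E := GinDepth.leadExps (P.map (GinDepth.coordChange α)) with hEdef
  have hup : IsUpperSet E := GinDepth.isUpperSet_leadExps _
  have hJE : J = Ideal.span ((fun w => monomial w (1 : k)) '' E) := by
    rw [← hUJ α hα, GinDepth.initialIdeal_eq_span]
  have hE : ∀ β ∈ U, GinDepth.leadExps (P.map (GinDepth.coordChange β)) = E := fun β hβ =>
    GinDepth.leadExps_eq_of_initialIdeal_eq ((hUJ β hβ).trans (hUJ α hα).symm)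
  obtain ⟨hpow, hinj⟩ := GinDepth.noether_position hc hP hd hU ⟨α, hα⟩ hE
  have hfin := GinDepth.lowStandard_finite hup hpow
  have hcn : c ≤ n := by omega
  have hfin' : (GinDepth.lowStandard c (GinDepth.phiExps c E)).Finite :=
    hfin.subset fun v hv => ⟨hv.1, fun h => hv.2 (GinDepth.subset_phiExps c E h)⟩
  rw [hJE, GinDepth.deg_Phi hup hcn hfin', GinDepth.deg_map_piHom hup hcn hfin] at hdeg
  obtain ⟨u, hu, huE, huniq, hex⟩ :=
    GinDepth.exists_unique_low hup hfin (by exact_mod_cast hdeg)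
  obtain ⟨hlt, e, he, hmem, hshape⟩ :=
    GinDepth.exists_generator_shape hP hU ⟨α, hα⟩ hE hinj hu huE huniq hex
  have hcomp := GinDepth.componentClosed_of_isHomogeneousIdeal hhom
  have hdepth : GinDepth.depthQuot P = (n - (c + 1) : ℕ) :=
    GinDepth.depthQuot_map_coordChange hP.ne_top hcomp α
      (GinDepth.hasMaximalRegularSequence_of_shape (hcomp.map_coordChange α) hpow hlt hu huE he
        hmem hshape)
  -- This form also contains `d ≥ 1`, which comes from `c < n`.
  have hdepth' : GinDepth.depthQuot P + 1 = (d : ℕ∞) := by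
    rw [hdepth, show d = n - (c + 1) + 1 by omega]
    push_cast
    rfl
  refine ⟨?_, ⟨⟨c, hlt⟩, rfl, u + Finsupp.single ⟨c, hlt⟩ e, ?_, ?_⟩, hdepth', ?_⟩
  · rw [hJE]
    exact GinDepth.span_monomial_eq_span_inter_supported hu hlt hmem hshape
  · rw [hJE, GinDepth.minGens_span_monomial hup]
    -- A smaller `v` in `E` whose low part is in `E` would put `u` in `E`, as that low part lies
    -- below `u`.
    refine ⟨hmem, fun v hv hle => hshape v hv fun h => huE (hup ?_ h)⟩
    have := GinDepth.cut_mono c hle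
    rwa [GinDepth.cut_add_single hu] at this
  · rw [Finsupp.add_apply, Finsupp.single_eq_same]
    omega
  · rw [GinDepth.IsAlmostCohenMacaulay, hd, hdepth']
    rfl
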